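/- Fix an integer $m\ge 2$ and generators $X=\{x_1,\dots,x_m\}$. For $\ell\ge 1$ let $B_\ell$ be the (finite) set of nonempty cyclically reduced words of length at most $\ell$ in the letters $x_1^{\pm1},\dots,x_m^{\pm1}$. For each $\ell$ let $R_\ell$ be a random subset of $B_\ell$, that is, a random variable with values in the set of all subsets of $B_\ell$. Assume that each $R_\ell$ is permutation invariant: $\Pr(R_\ell=a)=\Pr(R_\ell=\sigma(a))$ for every $a\subset B_\ell$ and every permutation $\sigma$ of the set $B_\ell$. Assume also that the sequence $(R_\ell)$ is densable with density $d\in\{-\infty\}\cup[0,1]$: the random variables $\log|R_\ell|/\log|B_\ell|$ (with value $-\infty$ when $R_\ell=\emptyset$) converge in distribution to the constant $d$ as $\ell\to\infty$. Let $0<\lambda<1$. For a set $R$ of nonempty cyclically reduced words, let $R^*$ be the set of all cyclic permutations of the elements of $R$ and of their inverses. A piece is a common initial segment of two distinct elements of $R^*$, and the presentation $\langle X\mid R\rangle$ satisfies $C'(\lambda)$ if $|b|<\lambda|r|$ whenever $r\in R^*$ and $b$ is a piece that is an initial segment of $r$. 1. If $d<\lambda/2$, then $\Pr\big(\langle X\mid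 R_\ell\rangle \text{ satisfies } C'(\lambda)\big)\to 1$ as $\ell\to\infty$. 2. If $d>\lambda/2$, then $\Pr\big(\langle X\mid R_\ell\rangle \text{ does not satisfy } C'(\lambda)\big)\to 1$ as $\ell\to\infty$. -/

import Mathlib

open MeasureTheory Filter Topology

noncomputable section

/-! ### Random subsets of finite sets -/

/-- `A : Ω → Finset E` is a random subset of the finite set `E`: a random variable on the
probability space `(Ω, P)` with values in the (discrete) set of all subsets of `E`. -/
def IsRandomSubset {Ω E : Type*} [MeasurableSpace Ω] (A : Ω → Finset E) : Prop :=
  ∀ a : Finset E, MeasurableSet {ω | A ω = a}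

/-- The law of the random subset `A` of `E` is invariant under all permutations of `E`. -/
def IsPermutationInvariant {Ω E : Type*} [MeasurableSpace Ω] (P : Measure Ω)
    (A : Ω → Finset E) : Prop :=
  ∀ (a : Finset E) (σ : Equiv.Perm E), P {ω | A ω = a} = P {ω | A ω = a.map σ.toEmbedding}

/-- The density `log |A| / log |E|` of a subset `A` of the finite set `E`,
with value `-∞` if `A` is empty. -/
def density {E : Type*} [Fintype E] (A : Finset E) : EReal :=
  open scoped Classical in
  if A = ∅ then ⊥ else ((Real.log A.card / Real.log (Fintype.card E) : ℝ) : EReal)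

/-- The sequence `A` of random subsets of the finite sets `E 0, E 1, …` is densable with
density `d`: the random variables `density (A n)` converge in distribution to the constant `d`. -/
def IsDensable {Ω E : ℕ → Type*} [∀ n, MeasurableSpace (Ω n)] [∀ n, Fintype (E n)]
    (P : ∀ n, Measure (Ω n)) [∀ n, IsProbabilityMeasure (P n)]
    (A : ∀ n, Ω n → Finset (E n)) (d : EReal) : Prop :=
  TendstoInDistribution (fun n ω => density (A n ω)) atTop (fun _ : Unit => d) P
    (Measure.dirac ())

/-- The events `Q n` hold asymptotically almost surely. -/
def AsymptoticallyAlmostSurely {Ω : ℕ → Type*} [∀ n, MeasurableSpace (Ω n)]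
    (P : ∀ n, Measure (Ω n)) (Q : ∀ n, Ω n → Prop) : Prop :=
  Tendsto (fun n => P n {ω | Q n ω}) atTop (𝓝 1)

/-! ### Words and small cancellation

A word on `x_1^±, …, x_m^±` is a list of letters `(i, ε)`, where `i : Fin m` is the index of
the generator and `ε : Bool` is the sign of the exponent. -/

/-- The set of nonempty cyclically reduced words of length at most `ℓ` in `m` generators. -/
def CyclicallyReducedWord (m ℓ : ℕ) : Type :=
  {w : List (Fin m × Bool) // FreeGroup.IsCyclicallyReduced w ∧ w ≠ [] ∧ w.length ≤ ℓ}

instance (m ℓ : ℕ) : Finite (CyclicallyReducedWord m ℓ) :=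
  Set.Finite.to_subtype ((List.finite_length_le (Fin m × Bool) ℓ).subset fun _ hw => hw.2.2)

instance (m ℓ : ℕ) : Fintype (CyclicallyReducedWord m ℓ) := Fintype.ofFinite _

/-- The set of words underlying a set of relators of length at most `ℓ`. -/
def relatorWords {m ℓ : ℕ} (R : Finset (CyclicallyReducedWord m ℓ)) :
    Set (List (Fin m × Bool)) :=
  {w | ∃ r ∈ R, r.val = w}

/-- The symmetrized set generated by a set `R` of cyclically reduced words: all cyclic
permutations of the elements of `R` and of their inverses. -/
def symmetrizedClosure {α : Type*} (R : Set (List (α × Bool))) : Set (List (α × Bool)) :=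
  {w | ∃ r ∈ R, w.IsRotated r ∨ w.IsRotated (FreeGroup.invRev r)}

/-- A piece relative to `R` is a common initial segment of two distinct elements of the
symmetrized set generated by `R`. -/
def IsPiece {α : Type*} (R : Set (List (α × Bool))) (b : List (α × Bool)) : Prop :=
  ∃ r₁ ∈ symmetrizedClosure R, ∃ r₂ ∈ symmetrizedClosure R, r₁ ≠ r₂ ∧ b <+: r₁ ∧ b <+: r₂

/-- The small cancellation condition `C'(lam)` for the presentation with set of relators `R`:
every piece `b` that is an initial segment of an element `r` of the symmetrized set generated
by `R` satisfies `|b| < lam * |r|`. -/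
def SmallCancellation {α : Type*} (lam : ℝ) (R : Set (List (α × Bool))) : Prop :=
  ∀ r ∈ symmetrizedClosure R, ∀ b, IsPiece R b → b <+: r →
    (b.length : ℝ) < lam * (r.length : ℝ)

/-- The presentations `⟨x_1, …, x_m | R ℓ⟩`, for `ℓ = 0, 1, …`, form a sequence of random groups
with density `d`: `R` is a densable sequence, with density `d`, of permutation invariant random
subsets of the sets of cyclically reduced words of length at most `ℓ`. -/
structure IsRandomGroupSequence (m : ℕ) (d : EReal) {Ω : ℕ → Type*}
    [∀ ℓ, MeasurableSpace (Ω ℓ)] (P : ∀ ℓ, Measure (Ω ℓ)) [∀ ℓ, IsProbabilityMeasure (P ℓ)]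
    (R : ∀ ℓ, Ω ℓ → Finset (CyclicallyReducedWord m ℓ)) : Prop where
  isRandomSubset : ∀ ℓ, IsRandomSubset (R ℓ)
  permutationInvariant : ∀ ℓ, IsPermutationInvariant (P ℓ) (R ℓ)
  densable : IsDensable P R d

end

/-!
Let `q = 2m - 1`, and let `N` be the number of nonempty cyclically reduced words of length at most
`ℓ`; up to polynomial factors `N` is `q ^ ℓ`. Given its cardinality `k`, a permutation invariant
random set of relators is uniform among the `k`-element sets, so that it suffices to bound
proportions of `k`-element sets (`IsPermutationInvariant.measureReal_le`), where densability makes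
`k` close to `N ^ d` (`IsDensable.tendsto_measure_of_isOpen`).

Density below `lam / 2`. If `C'(lam)` fails, then two distinct elements `r, r'` of the symmetrized
set share an initial segment of length at least `lam |r|`. If they come from different relators,
that segment of `r'` is determined by `r`, which leaves about `q ^ ((2 - lam) ℓ)` pairs of words;
such a pair of relators occurs with probability at most about `(k / N) ^ 2` times this number, or
`q ^ ((2 d - lam) ℓ)`. If they come from the same relator, then `r'` is a rotation of `r` or of its
inverse, and the overlap equates, up to inversion, the letter at each position `i` of the segment
with the letter at another position `f i`. The later of the two positions is then determined by the
earlier one; since `f` is injective, at least half as many positions as the segment has letters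
are determined (`exists_card_le_of_overlap`). This leaves about `q ^ ((1 - lam / 2) ℓ)` words, and
the probability `k / N` of each of them yields `q ^ ((d - lam / 2) ℓ)`.

Density above `lam / 2`. To each word `s` belongs the block of all words that begin with the initial
segment of `s` of length `⌈lam |s|⌉`. Under `C'(lam)` no relator lies in the block of another one.
As initial segments of one word are comparable, if two blocks meet, then one of their two
base points lies in the block of the other. Hence the blocks of the
relators are disjoint, each has at least about `q ^ ((1 - lam) ℓ)` elements, and when they are chosen
one after the other, each choice has to avoid the blocks of all earlier ones. The proportion of
such `k`-element sets is at most about `exp (- k ^ 2 q ^ ((1 - lam) ℓ) / N)`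
(`Finset.card_filter_pairwise_notMem_le`), where `k ^ 2 q ^ ((1 - lam) ℓ) / N` is about
`q ^ ((2 d - lam) ℓ)` and tends to infinity.
-/

/-! ### Random subsets -/

theorem Finset.exists_perm_map_eq_of_card_eq {E : Type*} [Finite E] {a b : Finset E}
    (h : a.card = b.card) : ∃ σ : Equiv.Perm E, b = a.map σ.toEmbedding := by
  classical
  let e : {x // x ∈ a} ≃ {x // x ∈ b} := Finset.equivOfCardEq h
  refine ⟨e.extendSubtype, ?_⟩
  symm
  apply Finset.eq_of_subset_of_card_le
  · intro y hy
    obtain ⟨x, hx, rfl⟩ := Finset.mem_map.1 hy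
    exact e.extendSubtype_mem x hx
  · simp [h]

theorem IsRandomSubset.measureReal_mem {Ω E : Type*} [MeasurableSpace Ω] {P : Measure Ω}
    [IsProbabilityMeasure P] {A : Ω → Finset E} (hA : IsRandomSubset A) (S : Finset (Finset E)) :
    P.real {ω | A ω ∈ S} = ∑ a ∈ S, P.real {ω | A ω = a} := by
  have h : {ω | A ω ∈ S} = ⋃ a ∈ S, {ω | A ω = a} := by ext; simp
  rw [h, measureReal_biUnion_finset]
  · intro a _ b _ hab
    refine Set.disjoint_left.2 fun ω h₁ h₂ => hab ?_
    exact (show A ω = a from h₁).symm.trans h₂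
  · exact fun a _ => hA a

open scoped Classical in
/-- A permutation invariant random subset is uniform on the `k`-element subsets once its
cardinality `k` is given, so that a bound on the proportion of bad `k`-element subsets is a bound
on the probability of a bad set. -/
theorem IsPermutationInvariant.measureReal_le {Ω E : Type*} [MeasurableSpace Ω] [Fintype E]
    {P : Measure Ω} [IsProbabilityMeasure P] {A : Ω → Finset E} (hA : IsRandomSubset A)
    (hinv : IsPermutationInvariant P A) (Bad : Finset E → Prop) (K : Set ℕ) {ε : ℝ} (hε : 0 ≤ ε)
    (h : ∀ k ∈ K, (((Finset.univ : Finset (Finset E)).filter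
      (fun a => a.card = k ∧ Bad a)).card : ℝ) ≤ ε * (Fintype.card E).choose k) :
    P.real {ω | Bad (A ω) ∧ (A ω).card ∈ K} ≤ ε := by
  set p : Finset E → ℝ := fun a => P.real {ω | A ω = a} with hp
  have hp0 : ∀ a, 0 ≤ p a := fun a => measureReal_nonneg
  have hpeq : ∀ a b : Finset E, a.card = b.card → p a = p b := by
    intro a b hab
    obtain ⟨σ, rfl⟩ := Finset.exists_perm_map_eq_of_card_eq hab
    simp only [hp, Measure.real, hinv a σ]
  have hset : {ω | Bad (A ω) ∧ (A ω).card ∈ K} =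
      {ω | A ω ∈ (Finset.univ : Finset (Finset E)).filter (fun a => Bad a ∧ a.card ∈ K)} := by
    ext; simp
  have hone : ∑ a : Finset E, p a = 1 := by
    rw [← hA.measureReal_mem]; simp
  rw [hset, hA.measureReal_mem, Finset.sum_filter]
  calc ∑ a : Finset E, (if Bad a ∧ a.card ∈ K then p a else 0)
      = ∑ k ∈ Finset.range (Fintype.card E + 1), ∑ a : Finset E with a.card = k,
          (if Bad a ∧ a.card ∈ K then p a else 0) := by
        refine (Finset.sum_fiberwise_of_maps_to (fun a _ => ?_) _).symm
        simpa [Nat.lt_succ_iff] using Finset.card_le_univ a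
    _ ≤ ∑ k ∈ Finset.range (Fintype.card E + 1), ε * ∑ a : Finset E with a.card = k, p a := by
        refine Finset.sum_le_sum fun k hk => ?_
        by_cases hkK : k ∈ K
        · have hkN : k ≤ Fintype.card E := Nat.lt_succ_iff.1 (Finset.mem_range.1 hk)
          obtain ⟨a₀, -, ha₀⟩ := Finset.exists_subset_card_eq
            (s := (Finset.univ : Finset E)) (n := k) (by simpa using hkN)
          have h1 : ∑ a : Finset E with a.card = k, p a = (Fintype.card E).choose k * p a₀ := by
            rw [Finset.sum_congr rfl (g := fun _ => p a₀)
              (fun a ha => hpeq a a₀ (by rw [ha₀]; simpa using ha)), Finset.sum_const,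
              nsmul_eq_mul]
            congr 2
            rw [← Finset.card_univ, ← Finset.card_powersetCard]
            congr 1
            ext a
            simp
          have h2 : ∑ a : Finset E with a.card = k, (if Bad a ∧ a.card ∈ K then p a else 0)
              = ((Finset.univ : Finset (Finset E)).filter
                (fun a => a.card = k ∧ Bad a)).card * p a₀ := by
            rw [← Finset.sum_filter, Finset.filter_filter, Finset.sum_congr rfl (g := fun _ => p a₀)
              (fun a ha => hpeq a a₀ (by rw [ha₀]; exact (Finset.mem_filter.1 ha).2.1)),
              Finset.sum_const, nsmul_eq_mul]
            congr 3
            ext a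
            simp only [Finset.mem_filter, Finset.mem_univ, true_and]
            exact ⟨fun h => ⟨h.1, h.2.1⟩, fun h => ⟨h.1, h.2, h.1 ▸ hkK⟩⟩
          rw [h1, h2, ← mul_assoc]
          exact mul_le_mul_of_nonneg_right (h k hkK) (hp0 _)
        · rw [Finset.sum_eq_zero]
          · exact mul_nonneg hε (Finset.sum_nonneg fun a _ => hp0 a)
          · intro a ha
            rw [if_neg]
            rintro ⟨-, h⟩
            exact hkK ((Finset.mem_filter.1 ha).2 ▸ h)
    _ = ε * ∑ a : Finset E, p a := by
        rw [← Finset.mul_sum, Finset.sum_fiberwise_of_maps_to]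
        intro a _
        simpa [Nat.lt_succ_iff] using Finset.card_le_univ a
    _ = ε := by rw [hone, mul_one]

open scoped Classical in
theorem Finset.card_filter_card_eq_and_subset_le {E : Type*} [Fintype E] (T : Finset E) (k : ℕ) :
    ((Finset.univ : Finset (Finset E)).filter (fun a => a.card = k ∧ T ⊆ a)).card ≤
      (Fintype.card E - T.card).choose (k - T.card) := by
  rw [← Finset.card_compl, ← Finset.card_powersetCard]
  refine Finset.card_le_card_of_injOn (fun a => a \ T) ?_ ?_
  · intro a ha
    obtain ⟨-, rfl, hT⟩ := Finset.mem_filter.1 ha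
    rw [Finset.mem_coe, Finset.mem_powersetCard]
    refine ⟨fun x hx => ?_, Finset.card_sdiff_of_subset hT⟩
    simpa using (Finset.mem_sdiff.1 hx).2
  · intro a ha b hb hab
    obtain ⟨-, -, hTa⟩ := Finset.mem_filter.1 ha
    obtain ⟨-, -, hTb⟩ := Finset.mem_filter.1 hb
    rw [← Finset.sdiff_union_of_subset hTa, ← Finset.sdiff_union_of_subset hTb]
    exact congrArg (· ∪ T) hab

open scoped Classical in
theorem Finset.card_filter_card_eq_and_mem_le {E : Type*} [Fintype E] (s : E) (k : ℕ) :
    (((Finset.univ : Finset (Finset E)).filter (fun a => a.card = k ∧ s ∈ a)).card : ℝ) ≤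
      (k / Fintype.card E : ℝ) * (Fintype.card E).choose k := by
  have hN : 0 < Fintype.card E := Fintype.card_pos_iff.2 ⟨s⟩
  rcases Nat.eq_zero_or_pos k with rfl | hk
  · rw [Finset.filter_eq_empty_iff.2]
    · simp
    · rintro a - ⟨h0, hs⟩
      exact (Finset.card_ne_zero_of_mem hs) h0
  have h := Finset.card_filter_card_eq_and_subset_le ({s} : Finset E) k
  simp only [Finset.singleton_subset_iff, Finset.card_singleton] at h
  obtain ⟨n, hn⟩ := Nat.exists_eq_succ_of_ne_zero hN.ne'
  obtain ⟨j, rfl⟩ := Nat.exists_eq_succ_of_ne_zero hk.ne'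
  rw [hn] at h ⊢
  have h2 : ((n + 1) * n.choose j : ℝ) = (n + 1).choose (j + 1) * (j + 1) := by
    exact_mod_cast Nat.add_one_mul_choose_eq n j
  refine (Nat.cast_le.2 h).trans ?_
  simp only [Nat.succ_eq_add_one, Nat.add_sub_cancel, Nat.cast_add, Nat.cast_one]
  rw [div_mul_eq_mul_div, le_div_iff₀ (by positivity)]
  linarith

open scoped Classical in
theorem Finset.card_filter_card_eq_and_pair_mem_le {E : Type*} [Fintype E] {s t : E} (hst : s ≠ t)
    (k : ℕ) :
    (((Finset.univ : Finset (Finset E)).filter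
      (fun a => a.card = k ∧ s ∈ a ∧ t ∈ a)).card : ℝ) ≤
      (k / Fintype.card E : ℝ) ^ 2 * (Fintype.card E).choose k := by
  have hN : 2 ≤ Fintype.card E := by
    rw [← Finset.card_pair hst]; exact Finset.card_le_univ _
  have h := Finset.card_filter_card_eq_and_subset_le ({s, t} : Finset E) k
  simp only [Finset.insert_subset_iff, Finset.singleton_subset_iff, Finset.card_pair hst] at h
  by_cases hk : k < 2
  · have : ((Finset.univ : Finset (Finset E)).filter
      (fun a => a.card = k ∧ s ∈ a ∧ t ∈ a)) = ∅ := by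
      refine Finset.filter_eq_empty_iff.2 ?_
      rintro a - ⟨h0, hs, ht⟩
      have : ({s, t} : Finset E) ⊆ a := by simp [Finset.insert_subset_iff, hs, ht]
      have := Finset.card_le_card this
      rw [Finset.card_pair hst] at this
      omega
    rw [this]
    simp only [Finset.card_empty, Nat.cast_zero]
    positivity
  by_cases hkN : k ≤ Fintype.card E
  swap
  · rw [Nat.choose_eq_zero_of_lt (by omega)] at h
    refine (Nat.cast_le.2 h).trans ?_
    simp only [Nat.cast_zero]
    positivity
  obtain ⟨n, hn⟩ := Nat.exists_eq_add_of_le' hN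
  obtain ⟨j, rfl⟩ := Nat.exists_eq_add_of_le' (not_lt.1 hk)
  rw [hn] at h hkN ⊢
  have h2 : ((n + 1) * n.choose j : ℝ) = (n + 1).choose (j + 1) * (j + 1) := by
    exact_mod_cast Nat.add_one_mul_choose_eq n j
  have h3 : ((n + 2) * (n + 1).choose (j + 1) : ℝ) = (n + 2).choose (j + 2) * (j + 2) := by
    exact_mod_cast Nat.add_one_mul_choose_eq (n + 1) (j + 1)
  refine (Nat.cast_le.2 h).trans ?_
  simp only [Nat.add_sub_cancel, Nat.cast_add, Nat.cast_ofNat]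
  have hjn : (j : ℝ) ≤ n := by exact_mod_cast (by omega : j ≤ n)
  have e : (n.choose j : ℝ) =
      ((j + 1) / (n + 1)) * ((j + 2) / (n + 2)) * (n + 2).choose (j + 2) := by
    field_simp
    linear_combination (n + 2 : ℝ) * h2 + (j + 1 : ℝ) * h3
  rw [e, sq]
  gcongr ?_ * _ * _
  rw [div_le_div_iff₀ (by positivity) (by positivity)]
  nlinarith

open scoped Classical in
/-- The first moment bound: the proportion of `k`-element subsets that contain an element of `S`,
or two distinct elements related by `T`. -/
theorem Finset.card_filter_exists_mem_or_exists_pair_le {E : Type*} [Fintype E]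
    (S : Finset E) (T : Finset (E × E)) (k : ℕ) :
    (((Finset.univ : Finset (Finset E)).filter (fun a => a.card = k ∧
      ((∃ s ∈ a, s ∈ S) ∨ ∃ s ∈ a, ∃ t ∈ a, s ≠ t ∧ (s, t) ∈ T))).card : ℝ) ≤
      (S.card * (k / Fintype.card E : ℝ) + T.card * (k / Fintype.card E : ℝ) ^ 2) *
        (Fintype.card E).choose k := by
  have hsub : (Finset.univ : Finset (Finset E)).filter (fun a => a.card = k ∧
      ((∃ s ∈ a, s ∈ S) ∨ ∃ s ∈ a, ∃ t ∈ a, s ≠ t ∧ (s, t) ∈ T)) ⊆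
      (S.biUnion fun s => Finset.univ.filter (fun a : Finset E => a.card = k ∧ s ∈ a)) ∪
      ((T.filter fun x => x.1 ≠ x.2).biUnion fun x =>
        Finset.univ.filter (fun a : Finset E => a.card = k ∧ x.1 ∈ a ∧ x.2 ∈ a)) := by
    intro a ha
    obtain ⟨-, hk, ⟨s, hs, hS⟩ | ⟨s, hs, t, ht, hne, hT⟩⟩ := Finset.mem_filter.1 ha
    · exact Finset.mem_union_left _ (Finset.mem_biUnion.2 ⟨s, hS, by simp [hk, hs]⟩)
    · exact Finset.mem_union_right _ (Finset.mem_biUnion.2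
        ⟨(s, t), Finset.mem_filter.2 ⟨hT, hne⟩, by simp [hk, hs, ht]⟩)
  have h := (Finset.card_le_card hsub).trans ((Finset.card_union_le _ _).trans
    (add_le_add Finset.card_biUnion_le Finset.card_biUnion_le))
  refine (Nat.cast_le.2 h).trans ?_
  push_cast
  rw [add_mul]
  refine add_le_add ?_ ?_
  · refine (Finset.sum_le_card_nsmul _ _ _
      fun s _ => Finset.card_filter_card_eq_and_mem_le s k).trans ?_
    rw [nsmul_eq_mul, mul_assoc]
  · refine (Finset.sum_le_card_nsmul _ _ _ fun x hx =>
      Finset.card_filter_card_eq_and_pair_mem_le (Finset.mem_filter.1 hx).2 k).trans ?_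
    rw [nsmul_eq_mul, mul_assoc]
    gcongr
    exact Finset.filter_subset _ _

open scoped Classical in
/-- The birthday bound. Each point `a` has a block `nbr a` of at least `δ` points, and if two
blocks meet then one of their two base points lies in the block of the other. Then a
`k`-element set none of whose points lies in the block of another one is rare: its blocks are
disjoint, so that they leave at most `N - k δ` choices for an additional point. -/
theorem Finset.card_filter_pairwise_notMem_le {E : Type*} [Fintype E] (nbr : E → Finset E)
    (hnbr : ∀ a b, ¬ Disjoint (nbr a) (nbr b) → b ∈ nbr a ∨ a ∈ nbr b)
    {δ : ℕ} (hδ : 1 ≤ δ) (hcard : ∀ a, δ ≤ (nbr a).card) (k : ℕ) :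
    (((Finset.univ : Finset (Finset E)).filter (fun A => A.card = k ∧
      ∀ a ∈ A, ∀ b ∈ A, a ≠ b → b ∉ nbr a)).card : ℝ) ≤
      Real.exp (-((δ - 1) / Fintype.card E * (k * (k - 1) / 2))) *
        (Fintype.card E).choose k := by
  set N := Fintype.card E with hN
  set I : ℕ → Finset (Finset E) := fun k => Finset.univ.filter (fun A => A.card = k ∧
      ∀ a ∈ A, ∀ b ∈ A, a ≠ b → b ∉ nbr a) with hI
  have hIm : ∀ k A, A ∈ I k ↔ A.card = k ∧ ∀ a ∈ A, ∀ b ∈ A, a ≠ b → b ∉ nbr a := by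
    intro k A; simp [hI]
  have hU : ∀ k, ∀ A ∈ I k, k * δ ≤ (A.biUnion nbr).card := by
    intro k A hA
    obtain ⟨hAk, hA⟩ := (hIm k A).1 hA
    rw [Finset.card_biUnion, ← hAk]
    · rw [← smul_eq_mul]
      exact Finset.card_nsmul_le_sum _ _ _ fun a _ => hcard a
    · intro a ha b hb hab
      by_contra hd
      rcases hnbr a b hd with h | h
      · exact hA a ha b hb hab h
      · exact hA b hb a ha hab.symm h
  have hrec : ∀ k, ((k + 1 : ℕ) : ℝ) * (I (k + 1)).card ≤ (I k).card * ((N : ℝ) - k * δ) := by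
    intro k
    have h1 : (k + 1) * (I (k + 1)).card = ((I (k + 1)).sigma fun A => A).card := by
      rw [Finset.card_sigma, Finset.sum_congr rfl (g := fun _ => k + 1)
        (fun A hA => ((hIm _ A).1 hA).1), Finset.sum_const, smul_eq_mul, mul_comm]
    have h2 : ((I (k + 1)).sigma fun A => A).card ≤
        ((I k).sigma fun A => (A.biUnion nbr)ᶜ).card := by
      refine Finset.card_le_card_of_injOn (fun x => ⟨x.1.erase x.2, x.2⟩) ?_ ?_
      · rintro ⟨A, v⟩ hx
        obtain ⟨hA, hv⟩ := Finset.mem_sigma.1 hx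
        obtain ⟨hAk, hA⟩ := (hIm _ A).1 hA
        refine Finset.mem_sigma.2 ⟨(hIm _ _).2 ⟨?_, ?_⟩, ?_⟩
        · simp only [] at hv ⊢
          rw [Finset.card_erase_of_mem hv, hAk, Nat.add_sub_cancel]
        · intro a ha b hb
          exact hA a (Finset.mem_of_mem_erase ha) b (Finset.mem_of_mem_erase hb)
        · simp only [Finset.mem_compl, Finset.mem_biUnion, not_exists, not_and]
          intro a ha
          exact hA a (Finset.mem_of_mem_erase ha) v hv (Finset.ne_of_mem_erase ha)
      · rintro ⟨A, v⟩ hx ⟨B, w⟩ hy hxy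
        have hv := (Finset.mem_sigma.1 hx).2
        have hw := (Finset.mem_sigma.1 hy).2
        simp only [Sigma.mk.injEq, heq_eq_eq] at hxy hv hw
        obtain ⟨he, rfl⟩ := hxy
        rw [← Finset.insert_erase hv, he, Finset.insert_erase hw]
    have h3 : ((((I k).sigma fun A => (A.biUnion nbr)ᶜ).card : ℕ) : ℝ) ≤
        (I k).card * ((N : ℝ) - k * δ) := by
      rw [Finset.card_sigma, Nat.cast_sum, ← nsmul_eq_mul]
      refine Finset.sum_le_card_nsmul _ _ _ fun A hA => ?_
      rw [Finset.card_compl, Nat.cast_sub (Finset.card_le_univ _)]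
      have : ((k * δ : ℕ) : ℝ) ≤ (A.biUnion nbr).card := Nat.cast_le.2 (hU k A hA)
      push_cast at this
      linarith
    refine le_trans ?_ h3
    exact_mod_cast h1.le.trans h2
  have hδ' : (0 : ℝ) ≤ δ - 1 := by
    have : (1 : ℝ) ≤ δ := by exact_mod_cast hδ
    linarith
  change ((I k).card : ℝ) ≤ _
  induction k with
  | zero =>
    have : (I 0).card ≤ 1 := by
      refine Finset.card_le_one.2 fun a ha b hb => ?_
      rw [Finset.card_eq_zero.1 ((hIm _ a).1 ha).1, Finset.card_eq_zero.1 ((hIm _ b).1 hb).1]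
    simpa using this
  | succ k ih =>
    have hk := hrec k
    rcases le_or_gt ((N : ℝ) - k * δ) 0 with hneg | hpos
    · have h0 : ((k + 1 : ℕ) : ℝ) * (I (k + 1)).card ≤ 0 :=
        hk.trans (mul_nonpos_of_nonneg_of_nonpos (Nat.cast_nonneg _) hneg)
      have : ((I (k + 1)).card : ℝ) ≤ 0 := by
        by_contra hc
        have : 0 < ((k + 1 : ℕ) : ℝ) * (I (k + 1)).card := mul_pos (by positivity) (not_le.1 hc)
        linarith
      exact this.trans (by positivity)
    · have hkN : (k : ℝ) < N := by nlinarith [(Nat.cast_nonneg k : (0 : ℝ) ≤ k)]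
      have hN0 : (0 : ℝ) < N := lt_of_le_of_lt (Nat.cast_nonneg k) hkN
      set c : ℝ := (δ - 1) / N with hc
      have hstep : (N : ℝ) - k * δ ≤ (N - k) * Real.exp (-(c * k)) := by
        have h1 : 1 - c * k ≤ Real.exp (-(c * k)) := by
          have := Real.add_one_le_exp (-(c * k)); linarith
        have h2 : c * N = δ - 1 := by rw [hc]; field_simp
        have h3 : 0 ≤ c := div_nonneg hδ' hN0.le
        have h4 : (N - k) * (1 - c * k) ≤ (N - k) * Real.exp (-(c * k)) :=
          mul_le_mul_of_nonneg_left h1 (by linarith)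
        have h5 : (N - k) * (1 - c * k) = (N - k) - (c * N) * k + c * k * k := by ring
        rw [h2] at h5
        have : 0 ≤ c * k * k := by positivity
        nlinarith
      have hch : ((k + 1 : ℕ) : ℝ) * N.choose (k + 1) = N.choose k * (N - k) := by
        have : k ≤ N := by exact_mod_cast hkN.le
        rw [← Nat.cast_sub this, mul_comm]
        exact_mod_cast Nat.choose_succ_right_eq N k
      have hexp : Real.exp (-(c * (k * (k - 1) / 2))) * Real.exp (-(c * k)) =
          Real.exp (-(c * (((k + 1 : ℕ) : ℝ) * (((k + 1 : ℕ) : ℝ) - 1) / 2))) := by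
        rw [← Real.exp_add]; congr 1; push_cast; ring
      have : ((k + 1 : ℕ) : ℝ) * (I (k + 1)).card ≤ ((k + 1 : ℕ) : ℝ) *
          (Real.exp (-(c * (((k + 1 : ℕ) : ℝ) * (((k + 1 : ℕ) : ℝ) - 1) / 2))) *
            N.choose (k + 1)) :=
        calc _ ≤ _ := hk
          _ ≤ (Real.exp (-(c * (k * (k - 1) / 2))) * N.choose k) *
              ((N - k) * Real.exp (-(c * k))) :=
            mul_le_mul ih hstep hpos.le (by positivity)
          _ = _ := by
            rw [← hexp]
            linear_combination -(Real.exp (-(c * (k * (k - 1) / 2))) * Real.exp (-(c * k))) * hch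
      exact le_of_mul_le_mul_left this (by positivity)

/-! ### Densable sequences -/

theorem IsDensable.tendsto_measure_of_isOpen {Ω E : ℕ → Type*} [∀ n, MeasurableSpace (Ω n)]
    [∀ n, Fintype (E n)] {P : ∀ n, Measure (Ω n)} [∀ n, IsProbabilityMeasure (P n)]
    {A : ∀ n, Ω n → Finset (E n)} {d : EReal} (h : IsDensable P A d)
    {G : Set EReal} (hG : IsOpen G) (hd : d ∈ G) :
    Tendsto (fun n => P n {ω | density (A n ω) ∈ G}) atTop (𝓝 1) := by
  have h1 := ProbabilityMeasure.le_liminf_measure_open_of_tendsto h.tendsto hG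
  have h2 : ∀ n, (P n).map (fun ω => density (A n ω)) G = P n {ω | density (A n ω) ∈ G} :=
    fun n => Measure.map_apply_of_aemeasurable (h.forall_aemeasurable n) hG.measurableSet
  simp only [ProbabilityMeasure.coe_mk, h2] at h1
  rw [Measure.map_apply_of_aemeasurable h.aemeasurable_limit hG.measurableSet,
    Set.preimage_const_of_mem hd, measure_univ] at h1
  refine tendsto_of_le_liminf_of_limsup_le h1 ?_
  exact limsup_le_of_le (by isBoundedDefault) (Eventually.of_forall fun n => prob_le_one)

theorem card_le_rpow_of_density_lt {E : Type*} [Fintype E] (hE : 2 ≤ Fintype.card E)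
    {A : Finset E} {x : ℝ} (h : density A < (x : EReal)) :
    (A.card : ℝ) ≤ (Fintype.card E : ℝ) ^ x := by
  unfold density at h
  split_ifs at h with hA
  · simp only [hA, Finset.card_empty, Nat.cast_zero]
    positivity
  · have hE' : (1 : ℝ) < Fintype.card E := by exact_mod_cast (by omega : 1 < Fintype.card E)
    have hA' : (0 : ℝ) < A.card := by
      exact_mod_cast Finset.card_pos.2 (Finset.nonempty_iff_ne_empty.2 hA)
    rw [EReal.coe_lt_coe_iff, div_lt_iff₀ (Real.log_pos hE')] at h
    exact ((Real.lt_rpow_iff_log_lt hA' (by linarith)).2 h).le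

theorem rpow_le_card_of_lt_density {E : Type*} [Fintype E] (hE : 2 ≤ Fintype.card E)
    {A : Finset E} {x : ℝ} (h : (x : EReal) < density A) :
    (Fintype.card E : ℝ) ^ x ≤ (A.card : ℝ) := by
  unfold density at h
  split_ifs at h with hA
  · simp at h
  · have hE' : (1 : ℝ) < Fintype.card E := by exact_mod_cast (by omega : 1 < Fintype.card E)
    have hA' : (0 : ℝ) < A.card := by
      exact_mod_cast Finset.card_pos.2 (Finset.nonempty_iff_ne_empty.2 hA)
    rw [EReal.coe_lt_coe_iff, lt_div_iff₀ (Real.log_pos hE')] at h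
    exact ((Real.rpow_lt_iff_lt_log (by linarith) hA').2 h).le

open scoped Classical in
/-- If, for the cardinalities `k` that occur asymptotically almost surely, the proportion of bad
sets among the `k`-element sets tends to `0`, then asymptotically almost surely the set is not
bad. -/
theorem asymptoticallyAlmostSurely_of_proportion_tendsto_zero {Ω E : ℕ → Type*}
    [∀ n, MeasurableSpace (Ω n)] [∀ n, Fintype (E n)] {P : ∀ n, Measure (Ω n)}
    [∀ n, IsProbabilityMeasure (P n)] {A : ∀ n, Ω n → Finset (E n)}
    (hA : ∀ n, IsRandomSubset (A n)) (hinv : ∀ n, IsPermutationInvariant (P n) (A n))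
    (Bad : ∀ n, Finset (E n) → Prop) (K : ℕ → Set ℕ)
    (hK : Tendsto (fun n => P n {ω | (A n ω).card ∈ K n}) atTop (𝓝 1))
    {ε : ℕ → ℝ} (hε : Tendsto ε atTop (𝓝 0)) (hε0 : ∀ n, 0 ≤ ε n)
    (h : ∀ᶠ n in atTop, ∀ k ∈ K n, (((Finset.univ : Finset (Finset (E n))).filter
      (fun a => a.card = k ∧ Bad n a)).card : ℝ) ≤ ε n * (Fintype.card (E n)).choose k) :
    AsymptoticallyAlmostSurely P (fun n ω => ¬ Bad n (A n ω)) := by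
  have h1 : ∀ᶠ n in atTop, P n {ω | (A n ω).card ∈ K n} - ENNReal.ofReal (ε n) ≤
      P n {ω | ¬ Bad n (A n ω)} := by
    filter_upwards [h] with n hn
    have h2 : P n {ω | Bad n (A n ω) ∧ (A n ω).card ∈ K n} ≤ ENNReal.ofReal (ε n) := by
      rw [← ofReal_measureReal]
      exact ENNReal.ofReal_le_ofReal ((hinv n).measureReal_le (hA n) _ _ (hε0 n) hn)
    rw [tsub_le_iff_right]
    calc P n {ω | (A n ω).card ∈ K n}
        ≤ P n ({ω | ¬ Bad n (A n ω)} ∪ {ω | Bad n (A n ω) ∧ (A n ω).card ∈ K n}) := by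
          refine measure_mono fun ω hω => ?_
          by_cases hb : Bad n (A n ω)
          · exact Or.inr ⟨hb, hω⟩
          · exact Or.inl hb
      _ ≤ _ := (measure_union_le _ _).trans (by gcongr)
  have h3 : Tendsto (fun n => P n {ω | (A n ω).card ∈ K n} - ENNReal.ofReal (ε n)) atTop
      (𝓝 1) := by
    have := ENNReal.Tendsto.sub hK (ENNReal.tendsto_ofReal hε) (Or.inl ENNReal.one_ne_top)
    simpa using this
  exact tendsto_of_tendsto_of_tendsto_of_le_of_le' h3 tendsto_const_nhds h1
    (Eventually.of_forall fun n => prob_le_one)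

/-! ### Reduced words -/

theorem FreeGroup.IsReduced.take {α : Type*} {w : List (α × Bool)} (h : IsReduced w) (n : ℕ) :
    IsReduced (w.take n) :=
  h.infix (w.take_prefix n).isInfix

theorem FreeGroup.isReduced_concat {α : Type*} {w : List (α × Bool)} {x : α × Bool} :
    IsReduced (w ++ [x]) ↔ IsReduced w ∧ ∀ a ∈ w.getLast?, a.1 = x.1 → a.2 = x.2 := by
  simp [IsReduced, List.isChain_append]

theorem FreeGroup.IsReduced.invRev {α : Type*} {w : List (α × Bool)} (h : IsReduced w) :
    IsReduced (invRev w) := by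
  rw [isReduced_iff_not_step] at h ⊢
  intro v hv
  apply h (FreeGroup.invRev v)
  rw [← FreeGroup.Red.step_invRev_iff, FreeGroup.invRev_invRev]
  exact hv

/-- A rotation of `w` is a subword of `w ++ w`, which is reduced. -/
theorem FreeGroup.IsCyclicallyReduced.isReduced_of_isRotated {α : Type*} {w v : List (α × Bool)}
    (h : IsCyclicallyReduced w) (hv : v.IsRotated w) : IsReduced v := by
  obtain ⟨n, hn, rfl⟩ := List.isRotated_iff_mod.1 hv.symm
  have h2 : IsReduced (w ++ w) := by simpa using (h.flatten_replicate 2).isReduced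
  refine h2.infix ⟨w.take n, w.drop n, ?_⟩
  rw [List.rotate_eq_drop_append_take hn, ← List.append_assoc, List.take_append_drop,
    List.append_assoc, List.take_append_drop]

theorem FreeGroup.IsCyclicallyReduced.invRev {α : Type*} {w : List (α × Bool)}
    (h : IsCyclicallyReduced w) : IsCyclicallyReduced (invRev w) := by
  refine ⟨h.isReduced.invRev, ?_⟩
  have h2 := h.2
  simp only [FreeGroup.invRev, List.getLast?_reverse, List.head?_reverse, List.head?_map,
    List.getLast?_map, Option.mem_def, Option.map_eq_some_iff]
  rintro _ ⟨a, ha, rfl⟩ _ ⟨b, hb, rfl⟩ hab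
  simp only at hab ⊢
  rw [h2 b hb a ha hab.symm]

theorem FreeGroup.isRotated_invRev {α : Type*} {w v : List (α × Bool)}
    (h : w.IsRotated v) : (invRev w).IsRotated (invRev v) :=
  (h.map _).reverse

section Counting

variable {m : ℕ}

open FreeGroup

/-- The letters that may follow the word `w` in a reduced word. -/
def nextLetters (w : List (Fin m × Bool)) : Finset (Fin m × Bool) :=
  Finset.univ.filter fun x => ∀ a ∈ w.getLast?, a.1 = x.1 → a.2 = x.2

theorem card_nextLetters {w : List (Fin m × Bool)} (hw : w ≠ []) :
    (nextLetters w).card = 2 * m - 1 := by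
  have h : nextLetters w = Finset.univ.erase ((w.getLast hw).1, !(w.getLast hw).2) := by
    ext ⟨i, b⟩
    simp only [nextLetters, List.getLast?_eq_some_getLast hw, Option.mem_def, Option.some.injEq,
      forall_eq', Finset.mem_filter, Finset.mem_univ, true_and, Finset.mem_erase, and_true, ne_eq,
      Prod.mk.injEq, not_and]
    constructor
    · intro h hi hb
      rw [hb] at h
      simpa using h hi.symm
    · intro h hi
      have := h hi.symm
      revert this
      cases b <;> cases (w.getLast hw).2 <;> simp
  rw [h, Finset.card_erase_of_mem (Finset.mem_univ _)]
  simp [mul_comm]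

theorem card_nextLetters_le (w : List (Fin m × Bool)) : (nextLetters w).card ≤ 2 * m :=
  (Finset.card_le_univ _).trans (by simp [mul_comm])

/-- The reduced words of length `n`. -/
noncomputable def reducedWords (m n : ℕ) : Finset (List (Fin m × Bool)) :=
  open scoped Classical in
  (List.finite_length_eq (Fin m × Bool) n).toFinset.filter fun w => IsReduced w

theorem mem_reducedWords {n : ℕ} {w : List (Fin m × Bool)} :
    w ∈ reducedWords m n ↔ w.length = n ∧ IsReduced w := by
  simp [reducedWords]

/-- Each letter of a reduced word beyond the first one can be chosen in `2m - 1` ways, except that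
there is only one way at the positions in `D`, at which the letter is determined by the earlier
ones. -/
theorem card_le_of_determined (hm : 1 ≤ m) {n : ℕ} {S : Finset (List (Fin m × Bool))}
    (hS : S ⊆ reducedWords m n) {D : Finset ℕ} (hD : D ⊆ Finset.range n)
    (hdet : ∀ p ∈ D, ∀ w ∈ S, ∀ w' ∈ S, w.take p = w'.take p → w[p]? = w'[p]?) :
    S.card ≤ 2 * (2 * m - 1) ^ (n - D.card) := by
  induction n generalizing S D with
  | zero =>
    have : S ⊆ {[]} := fun w hw => by
      simpa using (mem_reducedWords.1 (hS hw)).1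
    have := Finset.card_le_card this
    simp only [Finset.card_singleton, zero_tsub, pow_zero, mul_one] at this ⊢
    omega
  | succ n ih =>
    have hlen : ∀ w ∈ S, w.length = n + 1 := fun w hw => (mem_reducedWords.1 (hS hw)).1
    have hT : S.image (List.take n) ⊆ reducedWords m n := by
      intro u hu
      obtain ⟨w, hw, rfl⟩ := Finset.mem_image.1 hu
      refine mem_reducedWords.2 ⟨by simp [hlen w hw], (mem_reducedWords.1 (hS hw)).2.take n⟩
    have hD' : D.erase n ⊆ Finset.range n := fun p hp => by
      have h1 := Finset.mem_range.1 (hD (Finset.mem_of_mem_erase hp))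
      have h2 := Finset.ne_of_mem_erase hp
      exact Finset.mem_range.2 (by omega)
    have hih := ih hT hD' (by
      intro p hp u hu u' hu' huu
      obtain ⟨w, hw, rfl⟩ := Finset.mem_image.1 hu
      obtain ⟨w', hw', rfl⟩ := Finset.mem_image.1 hu'
      have hpn := Finset.mem_range.1 (hD' hp)
      rw [List.getElem?_take_of_lt hpn, List.getElem?_take_of_lt hpn]
      rw [List.take_take, List.take_take, min_eq_left hpn.le] at huu
      exact hdet p (Finset.mem_of_mem_erase hp) w hw w' hw' huu)
    by_cases hn : n ∈ D
    · have hfib : S.card ≤ (S.image (List.take n)).card := by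
        refine le_of_eq (Finset.card_image_of_injOn ?_).symm
        intro w hw w' hw' hww
        refine List.ext_getElem? fun i => ?_
        rcases lt_trichotomy i n with hi | rfl | hi
        · rw [← List.getElem?_take_of_lt hi, ← List.getElem?_take_of_lt (l := w') hi]
          exact congrArg (·[i]?) hww
        · exact hdet i hn w hw w' hw' hww
        · rw [List.getElem?_eq_none (by rw [hlen w hw]; omega),
            List.getElem?_eq_none (by rw [hlen w' hw']; omega)]
      rw [Finset.card_erase_of_mem hn] at hih
      have hpos : 0 < D.card := Finset.card_pos.2 ⟨n, hn⟩
      rw [show n + 1 - D.card = n - (D.card - 1) by omega]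
      exact hfib.trans hih
    · rw [Finset.erase_eq_of_notMem hn] at hih hD'
      have hDn : D.card ≤ n := by simpa using Finset.card_le_card hD'
      have hfib : ∀ u ∈ S.image (List.take n),
          (S.filter fun w => w.take n = u).card ≤ (nextLetters u).card := by
        intro u hu
        have : S.filter (fun w => w.take n = u) ⊆ (nextLetters u).image (u ++ [·]) := by
          intro w hw
          obtain ⟨hwS, rfl⟩ := Finset.mem_filter.1 hw
          have hwe : w.take n ++ [w[n]'(by rw [hlen w hwS]; omega)] = w := by
            rw [List.take_append_getElem, List.take_of_length_le (hlen w hwS).le]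
          refine Finset.mem_image.2 ⟨_, ?_, hwe⟩
          have hr := (mem_reducedWords.1 (hS hwS)).2
          rw [← hwe, isReduced_concat] at hr
          exact Finset.mem_filter.2 ⟨Finset.mem_univ _, hr.2⟩
        exact (Finset.card_le_card this).trans Finset.card_image_le
      rcases Nat.eq_zero_or_pos n with rfl | hnpos
      · have h1 := Finset.card_le_mul_card_image S (2 * m)
          (fun u hu => (hfib u hu).trans (card_nextLetters_le u))
        have h2 : (S.image (List.take 0)).card ≤ 1 := by
          refine Finset.card_le_one.2 fun a ha b hb => ?_
          obtain ⟨-, -, rfl⟩ := Finset.mem_image.1 ha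
          obtain ⟨-, -, rfl⟩ := Finset.mem_image.1 hb
          rfl
        have hD0 : D.card = 0 := by omega
        rw [hD0]
        simp only [zero_add, tsub_zero, pow_one]
        calc S.card ≤ 2 * m * 1 := h1.trans (Nat.mul_le_mul_left _ h2)
          _ ≤ _ := by omega
      · have h1 := Finset.card_le_mul_card_image S (2 * m - 1) (fun u hu =>
          (hfib u hu).trans (card_nextLetters (by
            intro h
            have := (mem_reducedWords.1 (hT hu)).1
            rw [h] at this
            simp at this
            omega)).le)
        calc S.card ≤ (2 * m - 1) * (2 * (2 * m - 1) ^ (n - D.card)) :=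
              h1.trans (Nat.mul_le_mul_left _ hih)
          _ = _ := by
            rw [show n + 1 - D.card = (n - D.card) + 1 by omega, pow_succ]; ring

theorem card_reducedWords_le (hm : 1 ≤ m) (n : ℕ) :
    (reducedWords m n).card ≤ 2 * (2 * m - 1) ^ n := by
  simpa using card_le_of_determined hm (n := n) (Finset.Subset.refl _)
    (Finset.empty_subset _) (by simp)

theorem card_reducedWords_filter_take_le (hm : 1 ≤ m) {n t : ℕ} (ht : t ≤ n)
    (u : List (Fin m × Bool)) :
    ((reducedWords m n).filter fun w => w.take t = u).card ≤ 2 * (2 * m - 1) ^ (n - t) := by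
  have := card_le_of_determined hm (n := n) (S := (reducedWords m n).filter fun w => w.take t = u)
    (Finset.filter_subset _ _) (D := Finset.range t)
    (fun p hp => Finset.mem_range.2 ((Finset.mem_range.1 hp).trans_le ht)) (by
      intro p hp w hw w' hw' _
      have hp := Finset.mem_range.1 hp
      rw [← List.getElem?_take_of_lt hp, ← List.getElem?_take_of_lt (l := w') hp,
        (Finset.mem_filter.1 hw).2, (Finset.mem_filter.1 hw').2])
  simpa using this

/-- If a position `i < t` carries a letter that is determined by the letter at another position
`f i`, and vice versa, then the later one of the two positions is determined; at least `t / 2`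
positions arise like this when `f` is injective. -/
theorem exists_card_le_of_overlap (hm : 1 ≤ m) {n t : ℕ} (ht : t ≤ n)
    {S : Finset (List (Fin m × Bool))} (hS : S ⊆ reducedWords m n) (f : ℕ → ℕ)
    (hfn : ∀ i < t, f i < n) (hinj : Set.InjOn f (Set.Iio t)) (hfix : ∀ i < t, f i ≠ i)
    (g : Fin m × Bool → Fin m × Bool) (hg : Function.Involutive g)
    (h : ∀ w ∈ S, ∀ i < t, w[i]? = (w[f i]?).map g) :
    ∃ c ≤ n, t ≤ 2 * c ∧ S.card ≤ 2 * (2 * m - 1) ^ (n - c) := by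
  set D := (Finset.range t).image fun i => max i (f i) with hD
  have hDn : D ⊆ Finset.range n := by
    intro p hp
    obtain ⟨i, hi, rfl⟩ := Finset.mem_image.1 hp
    have hi := Finset.mem_range.1 hi
    exact Finset.mem_range.2 (max_lt (hi.trans_le ht) (hfn i hi))
  refine ⟨D.card, by simpa using Finset.card_le_card hDn, ?_, ?_⟩
  · have := Finset.card_le_mul_card_image (f := fun i => max i (f i)) (Finset.range t) 2 (by
      intro p _
      have hsub : (Finset.range t).filter (fun i => max i (f i) = p) ⊆
          insert p ((Finset.range t).filter fun i => f i = p) := by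
        intro i hi
        obtain ⟨hi, hp⟩ := Finset.mem_filter.1 hi
        rcases max_choice i (f i) with h | h
        · exact Finset.mem_insert.2 (Or.inl (h.symm.trans hp))
        · exact Finset.mem_insert.2 (Or.inr (Finset.mem_filter.2 ⟨hi, h.symm.trans hp⟩))
      refine (Finset.card_le_card hsub).trans ((Finset.card_insert_le _ _).trans ?_)
      have : ((Finset.range t).filter fun i => f i = p).card ≤ 1 := by
        refine Finset.card_le_one.2 fun a ha b hb => ?_
        obtain ⟨ha, hap⟩ := Finset.mem_filter.1 ha
        obtain ⟨hb, hbp⟩ := Finset.mem_filter.1 hb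
        exact hinj (Finset.mem_range.1 ha) (Finset.mem_range.1 hb) (hap.trans hbp.symm)
      omega)
    simpa using this
  · refine card_le_of_determined hm hS hDn ?_
    intro p hp w hw w' hw' hww
    obtain ⟨i, hi, rfl⟩ := Finset.mem_image.1 hp
    have hi := Finset.mem_range.1 hi
    have key : ∀ j < max i (f i), w[j]? = w'[j]? := fun j hj => by
      rw [← List.getElem?_take_of_lt hj, hww, List.getElem?_take_of_lt hj]
    have hr : ∀ v ∈ S, v[f i]? = (v[i]?).map g := fun v hv => by
      rw [h v hv i hi, Option.map_map, hg.comp_self, Option.map_id, id]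
    rcases lt_or_gt_of_ne (hfix i hi) with hlt | hlt
    · rw [max_eq_left hlt.le] at key ⊢
      rw [h w hw i hi, h w' hw' i hi, key _ hlt]
    · rw [max_eq_right hlt.le] at key ⊢
      rw [hr w hw, hr w' hw', key _ hlt]

theorem getElem?_invRev {w : List (Fin m × Bool)} {k : ℕ} (hk : k < w.length) :
    (invRev w)[k]? = (w[w.length - 1 - k]?).map fun x => (x.1, !x.2) := by
  rw [invRev, List.getElem?_reverse (by simpa using hk), List.getElem?_map, List.length_map]

open scoped Classical in
/-- A reduced word that shares an initial segment of length `t` with its rotation by `j` satisfies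
`w i = w (i + j)` for `i < t`, with indices modulo `n`. The shift of indices has no fixed point
unless the rotation is trivial, a case that the condition `w.rotate j ≠ w` excludes. -/
theorem exists_card_filter_rotate_le (hm : 1 ≤ m) {n t : ℕ} (ht : t ≤ n) (j : ℕ) :
    ∃ c ≤ n, t ≤ 2 * c ∧ ((reducedWords m n).filter
      fun w => w.rotate j ≠ w ∧ (w.rotate j).take t = w.take t).card ≤
        2 * (2 * m - 1) ^ (n - c) := by
  by_cases hj : n ∣ j
  · refine ⟨n, le_rfl, by omega, ?_⟩
    rw [Finset.filter_eq_empty_iff.2]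
    · simp
    · rintro w hw ⟨h, -⟩
      obtain ⟨k, rfl⟩ := hj
      rw [← (mem_reducedWords.1 hw).1, List.rotate_length_mul] at h
      exact h rfl
  · refine exists_card_le_of_overlap hm ht (Finset.filter_subset _ _) (fun i => (i + j) % n)
      (fun i hi => Nat.mod_lt _ (by omega)) ?_ ?_ id (fun _ => rfl) ?_
    · intro a ha b hb hab
      have h1 : a ≡ b [MOD n] := Nat.ModEq.add_right_cancel' j hab
      exact h1.eq_of_lt_of_lt (lt_of_lt_of_le ha ht) (lt_of_lt_of_le hb ht)
    · intro i hi h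
      have h1 : i + j ≡ i + 0 [MOD n] := by
        rw [Nat.ModEq, h, add_zero, Nat.mod_eq_of_lt (by omega)]
      exact hj ((Nat.modEq_zero_iff_dvd).1 (Nat.ModEq.add_left_cancel' i h1))
    · intro w hw i hi
      obtain ⟨hw, -, htake⟩ := Finset.mem_filter.1 hw
      have hl := (mem_reducedWords.1 hw).1
      rw [← List.getElem?_take_of_lt hi, ← htake, List.getElem?_take_of_lt hi,
        List.getElem?_rotate (by omega), hl, Option.map_id, id]

open scoped Classical in
/-- A reduced word that shares an initial segment of length `t` with a rotation of its inverse
satisfies `w i = (w (n - 1 - (i + j)))⁻¹` for `i < t`, with `i + j` taken modulo `n`. -/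
theorem exists_card_filter_rotate_invRev_le (hm : 1 ≤ m) {n t : ℕ} (ht : t ≤ n) (j : ℕ) :
    ∃ c ≤ n, t ≤ 2 * c ∧ ((reducedWords m n).filter
      fun w => ((invRev w).rotate j).take t = w.take t).card ≤
        2 * (2 * m - 1) ^ (n - c) := by
  have hget : ∀ w ∈ (reducedWords m n).filter
      (fun w => ((invRev w).rotate j).take t = w.take t), ∀ i < t,
      w[i]? = (w[n - 1 - (i + j) % n]?).map fun x => (x.1, !x.2) := by
    intro w hw i hi
    obtain ⟨hw, htake⟩ := Finset.mem_filter.1 hw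
    have hl := (mem_reducedWords.1 hw).1
    have hl' : (invRev w).length = n := by rw [invRev_length, hl]
    rw [← List.getElem?_take_of_lt hi, ← htake, List.getElem?_take_of_lt hi,
      List.getElem?_rotate (by omega), hl',
      getElem?_invRev (by rw [hl]; exact Nat.mod_lt _ (by omega)), hl]
  by_cases hfix : ∀ i < t, n - 1 - (i + j) % n ≠ i
  · refine exists_card_le_of_overlap hm ht (Finset.filter_subset _ _)
      (fun i => n - 1 - (i + j) % n) (fun i hi => by omega) ?_ hfix _ ?_ hget
    · intro a ha b hb hab
      have hn : 0 < n := lt_of_le_of_lt (Nat.zero_le a) (lt_of_lt_of_le ha ht)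
      have h1 := Nat.mod_lt (a + j) hn
      have h2 := Nat.mod_lt (b + j) hn
      have h3 : (a + j) % n = (b + j) % n := by simp only at hab; omega
      have h4 : a ≡ b [MOD n] := Nat.ModEq.add_right_cancel' j h3
      exact h4.eq_of_lt_of_lt (lt_of_lt_of_le ha ht) (lt_of_lt_of_le hb ht)
    · intro x; simp
  · -- A letter differs from its inverse, so that a fixed position leaves no word at all.
    push Not at hfix
    obtain ⟨i, hi, hfi⟩ := hfix
    refine ⟨n, le_rfl, by omega, ?_⟩
    rw [Finset.eq_empty_of_forall_notMem (s := (reducedWords m n).filter _)]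
    · simp
    · intro w hw
      have h := hget w hw i hi
      have hl := (mem_reducedWords.1 (Finset.mem_filter.1 hw).1).1
      rw [hfi, List.getElem?_eq_getElem (by omega), Option.map_some, Option.some.injEq] at h
      have := congrArg Prod.snd h
      simp at this

/-- In rank at least two, a reduced word extends by one letter to a cyclically reduced word. -/
theorem exists_isCyclicallyReduced_concat (hm : 2 ≤ m) {w : List (Fin m × Bool)}
    (hw : IsReduced w) (hne : w ≠ []) : ∃ x, IsCyclicallyReduced (w ++ [x]) := by
  obtain ⟨⟨i, a⟩, hl⟩ : ∃ a, w.getLast? = some a := ⟨_, List.getLast?_eq_some_getLast hne⟩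
  obtain ⟨⟨j, b⟩, hh⟩ : ∃ b, w.head? = some b := ⟨_, List.head?_eq_some_head hne⟩
  have key : ∀ x : Fin m × Bool, (i = x.1 → a = x.2) → (x.1 = j → x.2 = b) →
      IsCyclicallyReduced (w ++ [x]) := by
    intro x h1 h2
    refine ⟨isReduced_concat.2 ⟨hw, ?_⟩, ?_⟩
    · rw [hl]; simpa using h1
    · rw [List.getLast?_concat, List.head?_append, hh]; simpa using h2
  by_cases hij : i = j → a = b
  · exact ⟨(i, a), key _ (fun _ => rfl) hij⟩
  · push Not at hij
    obtain ⟨rfl, -⟩ := hij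
    have : Nontrivial (Fin m) := Fin.nontrivial_iff_two_le.2 hm
    obtain ⟨k, hk⟩ := exists_ne i
    exact ⟨(k, true), key _ (fun h => absurd h.symm hk) (fun h => absurd h hk)⟩

/-- Each of `k` further letters of a reduced word with the nonempty initial segment `u` can be
chosen in `2m - 1` ways. -/
theorem pow_le_card_reducedWords_filter_prefix {u : List (Fin m × Bool)} (hu : IsReduced u)
    (hne : u ≠ []) (k : ℕ) :
    (2 * m - 1) ^ k ≤ ((reducedWords m (u.length + k)).filter fun w => u <+: w).card := by
  induction k with
  | zero =>
    rw [pow_zero]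
    refine Finset.card_pos.2 ⟨u, Finset.mem_filter.2 ⟨mem_reducedWords.2 ⟨rfl, hu⟩, ?_⟩⟩
    exact List.prefix_rfl
  | succ k ih =>
    set F := (reducedWords m (u.length + k)).filter fun w => u <+: w with hF
    have h1 : F.card * (2 * m - 1) = (F.sigma fun w => nextLetters w).card := by
      rw [Finset.card_sigma, Finset.sum_congr rfl (g := fun _ => 2 * m - 1), Finset.sum_const,
        smul_eq_mul]
      intro w hw
      refine card_nextLetters ?_
      rintro rfl
      exact hne (List.prefix_nil.1 (Finset.mem_filter.1 hw).2)
    calc (2 * m - 1) ^ (k + 1) ≤ F.card * (2 * m - 1) := by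
          rw [pow_succ]; exact Nat.mul_le_mul_right _ ih
      _ = _ := h1
      _ ≤ _ := by
        refine Finset.card_le_card_of_injOn (fun x => x.1 ++ [x.2]) ?_ ?_
        · rintro ⟨w, x⟩ hx
          obtain ⟨hw, hx⟩ := Finset.mem_sigma.1 hx
          obtain ⟨hw, hp⟩ := Finset.mem_filter.1 hw
          obtain ⟨hl, hr⟩ := mem_reducedWords.1 hw
          simp only at hx hw hp hl hr
          refine Finset.mem_filter.2 ⟨mem_reducedWords.2 ⟨?_, ?_⟩, ?_⟩
          · simp [hl, add_assoc]
          · exact isReduced_concat.2 ⟨hr, (Finset.mem_filter.1 hx).2⟩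
          · exact hp.trans (List.prefix_append _ _)
        · rintro ⟨w, x⟩ - ⟨w', x'⟩ - h
          obtain ⟨h1, h2⟩ := List.append_inj' h rfl
          simp only [List.cons.injEq, and_true] at h1 h2
          rw [h1, h2]

/-- The inclusion of the cyclically reduced words into the words. -/
def cyclicallyReducedWordEmbedding (m ℓ : ℕ) :
    CyclicallyReducedWord m ℓ ↪ List (Fin m × Bool) :=
  ⟨Subtype.val, Subtype.val_injective⟩

open scoped Classical in
/-- The words of length `ℓ` that begin with `u` account for the bound: their letters after `u` are
chosen freely, except for the last one, which makes the word cyclically reduced. -/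
theorem pow_le_card_cyclicallyReducedWord_prefix (hm : 2 ≤ m) {ℓ : ℕ} {u : List (Fin m × Bool)}
    (hu : IsReduced u) (hne : u ≠ []) (hl : u.length + 1 ≤ ℓ) :
    (2 * m - 1) ^ (ℓ - 1 - u.length) ≤ ((Finset.univ : Finset (CyclicallyReducedWord m ℓ)).filter
      fun s => u <+: s.val).card := by
  refine (pow_le_card_reducedWords_filter_prefix hu hne _).trans ?_
  rw [show u.length + (ℓ - 1 - u.length) = ℓ - 1 by omega]
  have hex : ∀ w ∈ (reducedWords m (ℓ - 1)).filter (fun w => u <+: w),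
      ∃ x, IsCyclicallyReduced (w ++ [x]) := by
    intro w hw
    obtain ⟨hw, hp⟩ := Finset.mem_filter.1 hw
    refine exists_isCyclicallyReduced_concat hm (mem_reducedWords.1 hw).2 ?_
    rintro rfl
    exact hne (List.prefix_nil.1 hp)
  have : Nonempty (Fin m × Bool) := ⟨(⟨0, by omega⟩, true)⟩
  choose! x hx using hex
  rw [← Finset.card_map (cyclicallyReducedWordEmbedding m ℓ)]
  refine Finset.card_le_card_of_injOn (fun w => w ++ [x w]) ?_ ?_
  · intro w hw
    have hw' := Finset.mem_filter.1 hw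
    have hlen := (mem_reducedWords.1 hw'.1).1
    refine Finset.mem_map.2 ⟨⟨w ++ [x w], hx w hw, by simp, ?_⟩, ?_, rfl⟩
    · simp [hlen]; omega
    · exact Finset.mem_filter.2 ⟨Finset.mem_univ _, hw'.2.trans (List.prefix_append _ _)⟩
  · intro w _ w' _ h
    exact (List.append_inj' h rfl).1

theorem pow_le_card_cyclicallyReducedWord (hm : 2 ≤ m) {ℓ : ℕ} (hl : 2 ≤ ℓ) :
    (2 * m - 1) ^ (ℓ - 2) ≤ Fintype.card (CyclicallyReducedWord m ℓ) := by
  classical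
  have := pow_le_card_cyclicallyReducedWord_prefix hm (ℓ := ℓ) (u := [(⟨0, by omega⟩, true)])
    IsReduced.singleton (by simp) (by simpa using hl)
  exact this.trans (Finset.card_le_univ _)

theorem card_cyclicallyReducedWord_le (hm : 1 ≤ m) (ℓ : ℕ) :
    Fintype.card (CyclicallyReducedWord m ℓ) ≤ 2 * (ℓ + 1) * (2 * m - 1) ^ ℓ := by
  classical
  rw [← Finset.card_univ, ← Finset.card_map (cyclicallyReducedWordEmbedding m ℓ)]
  have hsub : (Finset.univ : Finset (CyclicallyReducedWord m ℓ)).map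
      (cyclicallyReducedWordEmbedding m ℓ) ⊆
      (Finset.range (ℓ + 1)).biUnion fun n => reducedWords m n := by
    intro w hw
    obtain ⟨s, -, rfl⟩ := Finset.mem_map.1 hw
    exact Finset.mem_biUnion.2 ⟨s.val.length, Finset.mem_range.2 (Nat.lt_succ_iff.2 s.2.2.2),
      mem_reducedWords.2 ⟨rfl, s.2.1.isReduced⟩⟩
  refine (Finset.card_le_card hsub).trans ((Finset.card_biUnion_le_card_mul _ _
    (2 * (2 * m - 1) ^ ℓ) ?_).trans ?_)
  · intro n hn
    refine (card_reducedWords_le hm n).trans (Nat.mul_le_mul_left _ ?_)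
    exact Nat.pow_le_pow_right (by omega) (Nat.lt_succ_iff.1 (Finset.mem_range.1 hn))
  · simp only [Finset.card_range]
    exact le_of_eq (by ring)

end Counting

/-! ### Overlaps between relators -/

section Overlaps

open FreeGroup

variable {m ℓ : ℕ} {lam : ℝ}

/-- The cyclic permutations of the word `w` and of its inverse. -/
def conjugates (w : List (Fin m × Bool)) : Finset (List (Fin m × Bool)) :=
  w.cyclicPermutations.toFinset ∪ (invRev w).cyclicPermutations.toFinset

theorem mem_conjugates {w r : List (Fin m × Bool)} :
    r ∈ conjugates w ↔ r.IsRotated w ∨ r.IsRotated (invRev w) := by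
  simp [conjugates]

theorem mem_conjugates_symm {w r : List (Fin m × Bool)} (h : r ∈ conjugates w) :
    w ∈ conjugates r := by
  rw [mem_conjugates] at h ⊢
  rcases h with h | h
  · exact Or.inl h.symm
  · have := isRotated_invRev h
    rw [invRev_invRev] at this
    exact Or.inr this.symm

theorem mem_conjugates_trans {w r r' : List (Fin m × Bool)} (h : r ∈ conjugates w)
    (h' : r' ∈ conjugates r) : r' ∈ conjugates w := by
  rw [mem_conjugates] at h h' ⊢
  rcases h' with h' | h'
  · exact h.imp h'.trans h'.trans
  · rcases h with h | h
    · exact Or.inr (h'.trans (isRotated_invRev h))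
    · have := isRotated_invRev h
      rw [invRev_invRev] at this
      exact Or.inl (h'.trans this)

theorem length_of_mem_conjugates {w r : List (Fin m × Bool)} (h : r ∈ conjugates w) :
    r.length = w.length := by
  rcases mem_conjugates.1 h with h | h
  · exact h.perm.length_eq
  · rw [h.perm.length_eq, invRev_length]

theorem isReduced_of_mem_conjugates {w r : List (Fin m × Bool)} (hw : IsCyclicallyReduced w)
    (h : r ∈ conjugates w) : IsReduced r := by
  rcases mem_conjugates.1 h with h | h
  · exact hw.isReduced_of_isRotated h
  · exact hw.invRev.isReduced_of_isRotated h

theorem card_conjugates_le (w : List (Fin m × Bool)) :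
    (conjugates w).card ≤ 2 * (w.length + 1) := by
  have h : ∀ v : List (Fin m × Bool), v.cyclicPermutations.length ≤ v.length + 1 := by
    intro v
    by_cases hv : v = []
    · simp [hv]
    · rw [List.length_cyclicPermutations_of_ne_nil v hv]; omega
  have h1 := (List.toFinset_card_le w.cyclicPermutations).trans (h w)
  have h2 := (List.toFinset_card_le (invRev w).cyclicPermutations).trans (h (invRev w))
  rw [invRev_length] at h2
  exact (Finset.card_union_le _ _).trans (by omega)

theorem mem_symmetrizedClosure_relatorWords {R : Finset (CyclicallyReducedWord m ℓ)}
    {r : List (Fin m × Bool)} :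
    r ∈ symmetrizedClosure (relatorWords R) ↔ ∃ s ∈ R, r ∈ conjugates s.val := by
  simp only [symmetrizedClosure, relatorWords, mem_conjugates]
  constructor
  · rintro ⟨_, ⟨s, hs, rfl⟩, h⟩
    exact ⟨s, hs, h⟩
  · rintro ⟨s, hs, h⟩
    exact ⟨_, ⟨s, hs, rfl⟩, h⟩

open scoped Classical in
/-- The relators with two distinct conjugates that share a long initial segment. -/
noncomputable def selfOverlapping (lam : ℝ) (m ℓ : ℕ) : Finset (CyclicallyReducedWord m ℓ) :=
  Finset.univ.filter fun s => ∃ r ∈ conjugates s.val, ∃ r' ∈ conjugates s.val, r' ≠ r ∧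
    r'.take ⌈lam * r.length⌉₊ = r.take ⌈lam * r.length⌉₊

open scoped Classical in
/-- The pairs of relators that have conjugates sharing a long initial segment. -/
noncomputable def overlapping (lam : ℝ) (m ℓ : ℕ) :
    Finset (CyclicallyReducedWord m ℓ × CyclicallyReducedWord m ℓ) :=
  Finset.univ.filter fun x => ∃ r ∈ conjugates x.1.val, ∃ r' ∈ conjugates x.2.val,
    ⌈lam * r.length⌉₊ ≤ r'.length ∧ r'.take ⌈lam * r.length⌉₊ = r.take ⌈lam * r.length⌉₊

theorem exists_overlap_of_not_smallCancellation {R : Finset (CyclicallyReducedWord m ℓ)}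
    (h : ¬ SmallCancellation lam (relatorWords R)) :
    (∃ s ∈ R, s ∈ selfOverlapping lam m ℓ) ∨
      ∃ s ∈ R, ∃ t ∈ R, s ≠ t ∧ (s, t) ∈ overlapping lam m ℓ := by
  unfold SmallCancellation at h
  push Not at h
  obtain ⟨r, hr, b, ⟨r₁, hr₁, r₂, hr₂, hne, hb₁, hb₂⟩, hbr, hle⟩ := h
  obtain ⟨r', hr', hne', hbr'⟩ :
      ∃ r' ∈ symmetrizedClosure (relatorWords R), r' ≠ r ∧ b <+: r' := by
    by_cases h1 : r₁ = r
    · exact ⟨r₂, hr₂, fun h2 => hne (h1.trans h2.symm), hb₂⟩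
    · exact ⟨r₁, hr₁, h1, hb₁⟩
  have ht : ⌈lam * r.length⌉₊ ≤ b.length := Nat.ceil_le.2 hle
  have htake : r'.take ⌈lam * r.length⌉₊ = r.take ⌈lam * r.length⌉₊ := by
    obtain ⟨v, rfl⟩ := hbr'
    obtain ⟨u, hu⟩ := hbr
    rw [List.take_append_of_le_length ht, ← List.take_append_of_le_length (l₂ := u) ht, hu]
  obtain ⟨s, hs, hrs⟩ := mem_symmetrizedClosure_relatorWords.1 hr
  obtain ⟨s', hs', hrs'⟩ := mem_symmetrizedClosure_relatorWords.1 hr'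
  by_cases hss : s = s'
  · subst hss
    exact Or.inl ⟨s, hs, Finset.mem_filter.2
      ⟨Finset.mem_univ _, r, hrs, r', hrs', hne', htake⟩⟩
  · exact Or.inr ⟨s, hs, s', hs', hss, Finset.mem_filter.2
      ⟨Finset.mem_univ _, r, hrs, r', hrs', ht.trans hbr'.length_le, htake⟩⟩

theorem ceil_mul_length_le (hlam1 : lam < 1) (n : ℕ) : ⌈lam * n⌉₊ ≤ n :=
  Nat.ceil_le.2 (mul_le_of_le_one_left (Nat.cast_nonneg n) hlam1.le)

theorem pow_le_rpow_of_two_mul_le {q : ℕ} (hq : 1 ≤ q) (hlam1 : lam < 1) {n c : ℕ} (hn : n ≤ ℓ)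
    (hc : c ≤ n) (h : ⌈lam * n⌉₊ ≤ 2 * c) :
    ((q ^ (n - c) : ℕ) : ℝ) ≤ (q : ℝ) ^ ((1 - lam / 2) * ℓ) := by
  have hq' : (1 : ℝ) ≤ q := by exact_mod_cast hq
  rw [Nat.cast_pow, ← Real.rpow_natCast, Nat.cast_sub hc]
  refine Real.rpow_le_rpow_of_exponent_le hq' ?_
  have h1 : lam * n ≤ 2 * c := by exact_mod_cast Nat.ceil_le.1 h
  have h2 : (n : ℝ) ≤ ℓ := by exact_mod_cast hn
  nlinarith

theorem card_selfOverlapping_le (hm : 1 ≤ m) (hlam1 : lam < 1) :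
    ((selfOverlapping lam m ℓ).card : ℝ) ≤
      8 * (ℓ + 1) ^ 3 * ((2 * m - 1 : ℕ) : ℝ) ^ ((1 - lam / 2) * ℓ) := by
  classical
  set q := 2 * m - 1 with hq
  have hq1 : 1 ≤ q := by omega
  let G : ℕ → ℕ → Finset (List (Fin m × Bool)) := fun n j =>
    ((reducedWords m n).filter fun w => w.rotate j ≠ w ∧
      (w.rotate j).take ⌈lam * n⌉₊ = w.take ⌈lam * n⌉₊) ∪
    (reducedWords m n).filter fun w =>
      ((invRev w).rotate j).take ⌈lam * n⌉₊ = w.take ⌈lam * n⌉₊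
  have hG : ∀ n ≤ ℓ, ∀ j, ((G n j).card : ℝ) ≤ 4 * (q : ℝ) ^ ((1 - lam / 2) * ℓ) := by
    intro n hn j
    obtain ⟨c, hc, ht, h⟩ := exists_card_filter_rotate_le hm (ceil_mul_length_le hlam1 n) j
    obtain ⟨c', hc', ht', h'⟩ :=
      exists_card_filter_rotate_invRev_le hm (ceil_mul_length_le hlam1 n) j
    have h1 := pow_le_rpow_of_two_mul_le hq1 hlam1 hn hc ht
    have h2 := pow_le_rpow_of_two_mul_le hq1 hlam1 hn hc' ht'
    have h3 : ((G n j).card : ℝ) ≤ 2 * (q ^ (n - c) : ℕ) + 2 * (q ^ (n - c') : ℕ) := by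
      exact_mod_cast (Finset.card_union_le _ _).trans (add_le_add h h')
    linarith
  have hsub : (selfOverlapping lam m ℓ).map (cyclicallyReducedWordEmbedding m ℓ) ⊆
      (Finset.range (ℓ + 1) ×ˢ Finset.range (ℓ + 1)).biUnion fun x =>
        (G x.1 x.2).biUnion conjugates := by
    intro w hw
    obtain ⟨s, hs, rfl⟩ := Finset.mem_map.1 hw
    obtain ⟨-, r, hr, r', hr', hne, htake⟩ := Finset.mem_filter.1 hs
    have hlen : r.length ≤ ℓ := (length_of_mem_conjugates hr).le.trans s.2.2.2
    have hrr := mem_conjugates_trans (mem_conjugates_symm hr) hr'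
    have hred : r ∈ reducedWords m r.length :=
      mem_reducedWords.2 ⟨rfl, isReduced_of_mem_conjugates s.2.1 hr⟩
    obtain ⟨j, hj, hjG⟩ : ∃ j ≤ r.length, r ∈ G r.length j := by
      rcases mem_conjugates.1 hrr with h | h
      · obtain ⟨j, hj, rfl⟩ := List.isRotated_iff_mod.1 h.symm
        exact ⟨j, hj, Finset.mem_union_left _ (Finset.mem_filter.2 ⟨hred, hne, htake⟩)⟩
      · obtain ⟨j, hj, rfl⟩ := List.isRotated_iff_mod.1 h.symm
        rw [invRev_length] at hj
        exact ⟨j, hj, Finset.mem_union_right _ (Finset.mem_filter.2 ⟨hred, htake⟩)⟩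
    refine Finset.mem_biUnion.2 ⟨(r.length, j), ?_, Finset.mem_biUnion.2
      ⟨r, hjG, mem_conjugates_symm hr⟩⟩
    simp only [Finset.mem_product, Finset.mem_range]
    omega
  have hcard := Finset.card_le_card hsub
  rw [Finset.card_map] at hcard
  calc ((selfOverlapping lam m ℓ).card : ℝ)
      ≤ ∑ x ∈ Finset.range (ℓ + 1) ×ˢ Finset.range (ℓ + 1),
          (((G x.1 x.2).biUnion conjugates).card : ℝ) := by
        exact_mod_cast hcard.trans Finset.card_biUnion_le
    _ ≤ (Finset.range (ℓ + 1) ×ˢ Finset.range (ℓ + 1)).card •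
          (4 * (q : ℝ) ^ ((1 - lam / 2) * ℓ) * (2 * (ℓ + 1))) := by
        refine Finset.sum_le_card_nsmul _ _ _ fun x hx => ?_
        have hx1 : x.1 ≤ ℓ := Nat.lt_succ_iff.1 (Finset.mem_range.1 (Finset.mem_product.1 hx).1)
        have h1 : ((G x.1 x.2).biUnion conjugates).card ≤ (G x.1 x.2).card * (2 * (ℓ + 1)) := by
          refine Finset.card_biUnion_le_card_mul _ _ _ fun w hw => ?_
          have hl : w.length = x.1 := by
            rcases Finset.mem_union.1 hw with hw | hw <;>
              exact (mem_reducedWords.1 (Finset.mem_filter.1 hw).1).1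
          refine (card_conjugates_le w).trans ?_
          omega
        calc (((G x.1 x.2).biUnion conjugates).card : ℝ)
            ≤ (G x.1 x.2).card * (2 * (ℓ + 1)) := by exact_mod_cast h1
          _ ≤ _ := mul_le_mul_of_nonneg_right (hG _ hx1 _) (by positivity)
    _ = _ := by
        rw [Finset.card_product, Finset.card_range, nsmul_eq_mul]
        push_cast
        ring

theorem card_overlapping_le (hm : 1 ≤ m) (hlam1 : lam < 1) :
    ((overlapping lam m ℓ).card : ℝ) ≤
      16 * (ℓ + 1) ^ 4 * (((2 * m - 1 : ℕ) : ℝ) ^ ((1 - lam / 2) * ℓ)) ^ 2 := by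
  classical
  set q := 2 * m - 1 with hq
  have hq1 : (1 : ℝ) ≤ q := by exact_mod_cast (by omega : 1 ≤ q)
  let I := Finset.range (ℓ + 1) ×ˢ Finset.range (ℓ + 1)
  let G : ℕ × ℕ → Finset (Σ _ : List (Fin m × Bool), List (Fin m × Bool)) := fun x =>
    (reducedWords m x.1).sigma fun r => (reducedWords m x.2).filter fun r' =>
      ⌈lam * x.1⌉₊ ≤ x.2 ∧ r'.take ⌈lam * x.1⌉₊ = r.take ⌈lam * x.1⌉₊
  have hG : ∀ x ∈ I, ((G x).card : ℝ) ≤ 4 * ((q : ℝ) ^ ((1 - lam / 2) * ℓ)) ^ 2 := by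
    rintro ⟨n, n'⟩ hx
    have hn : (n : ℝ) ≤ ℓ := by
      exact_mod_cast Nat.lt_succ_iff.1 (Finset.mem_range.1 (Finset.mem_product.1 hx).1)
    have hn' : (n' : ℝ) ≤ ℓ := by
      exact_mod_cast Nat.lt_succ_iff.1 (Finset.mem_range.1 (Finset.mem_product.1 hx).2)
    by_cases ht : ⌈lam * n⌉₊ ≤ n'
    · have h1 : (G (n, n')).card ≤ 2 * q ^ n * (2 * q ^ (n' - ⌈lam * n⌉₊)) := by
        rw [Finset.card_sigma]
        refine (Finset.sum_le_card_nsmul _ _ (2 * q ^ (n' - ⌈lam * n⌉₊)) fun r _ => ?_).trans ?_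
        · simp only [ht, true_and]
          exact card_reducedWords_filter_take_le hm ht _
        · exact Nat.mul_le_mul_right _ (card_reducedWords_le hm n)
      have h2 : (q : ℝ) ^ n * (q : ℝ) ^ (n' - ⌈lam * n⌉₊) ≤
          ((q : ℝ) ^ ((1 - lam / 2) * ℓ)) ^ 2 := by
        rw [← Real.rpow_natCast, ← Real.rpow_natCast, ← Real.rpow_natCast (_ ^ _),
          ← Real.rpow_mul (by linarith), ← Real.rpow_add (by linarith), Nat.cast_sub ht]
        refine Real.rpow_le_rpow_of_exponent_le hq1 ?_
        have := Nat.le_ceil (lam * n)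
        push_cast
        nlinarith
      calc ((G (n, n')).card : ℝ) ≤ 2 * q ^ n * (2 * q ^ (n' - ⌈lam * n⌉₊)) := by
            exact_mod_cast h1
        _ = 4 * ((q : ℝ) ^ n * (q : ℝ) ^ (n' - ⌈lam * n⌉₊)) := by ring
        _ ≤ _ := by linarith
    · have : (G (n, n')).card = 0 := by
        rw [Finset.card_sigma]
        simp [ht]
      rw [this, Nat.cast_zero]
      positivity
  have hsub : (overlapping lam m ℓ).map
      ((cyclicallyReducedWordEmbedding m ℓ).prodMap (cyclicallyReducedWordEmbedding m ℓ)) ⊆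
      I.biUnion fun x => (G x).biUnion fun y => conjugates y.1 ×ˢ conjugates y.2 := by
    intro w hw
    obtain ⟨⟨s, s'⟩, hs, rfl⟩ := Finset.mem_map.1 hw
    obtain ⟨-, r, hr, r', hr', hle, htake⟩ := Finset.mem_filter.1 hs
    have hlen : r.length ≤ ℓ := (length_of_mem_conjugates hr).le.trans s.2.2.2
    have hlen' : r'.length ≤ ℓ := (length_of_mem_conjugates hr').le.trans s'.2.2.2
    refine Finset.mem_biUnion.2 ⟨(r.length, r'.length), ?_, Finset.mem_biUnion.2
      ⟨⟨r, r'⟩, ?_, Finset.mem_product.2 ⟨mem_conjugates_symm hr, mem_conjugates_symm hr'⟩⟩⟩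
    · simp only [I, Finset.mem_product, Finset.mem_range]
      omega
    · exact Finset.mem_sigma.2
        ⟨mem_reducedWords.2 ⟨rfl, isReduced_of_mem_conjugates s.2.1 hr⟩, Finset.mem_filter.2
          ⟨mem_reducedWords.2 ⟨rfl, isReduced_of_mem_conjugates s'.2.1 hr'⟩, hle, htake⟩⟩
  have hcard := Finset.card_le_card hsub
  rw [Finset.card_map] at hcard
  calc ((overlapping lam m ℓ).card : ℝ)
      ≤ ∑ x ∈ I, (((G x).biUnion fun y => conjugates y.1 ×ˢ conjugates y.2).card : ℝ) := by
        exact_mod_cast hcard.trans Finset.card_biUnion_le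
    _ ≤ I.card • (4 * ((q : ℝ) ^ ((1 - lam / 2) * ℓ)) ^ 2 * (2 * (ℓ + 1) * (2 * (ℓ + 1)))) := by
        refine Finset.sum_le_card_nsmul _ _ _ fun x hx => ?_
        have hx1 : x.1 ≤ ℓ := Nat.lt_succ_iff.1 (Finset.mem_range.1 (Finset.mem_product.1 hx).1)
        have hx2 : x.2 ≤ ℓ := Nat.lt_succ_iff.1 (Finset.mem_range.1 (Finset.mem_product.1 hx).2)
        have h1 : ((G x).biUnion fun y => conjugates y.1 ×ˢ conjugates y.2).card ≤
            (G x).card * (2 * (ℓ + 1) * (2 * (ℓ + 1))) := by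
          refine Finset.card_biUnion_le_card_mul _ _ _ fun y hy => ?_
          obtain ⟨hy1, hy2⟩ := Finset.mem_sigma.1 hy
          have hl1 := (mem_reducedWords.1 hy1).1
          have hl2 := (mem_reducedWords.1 (Finset.mem_filter.1 hy2).1).1
          rw [Finset.card_product]
          exact Nat.mul_le_mul ((card_conjugates_le _).trans (by omega))
            ((card_conjugates_le _).trans (by omega))
        calc _ ≤ ((G x).card : ℝ) * (2 * (ℓ + 1) * (2 * (ℓ + 1))) := by exact_mod_cast h1
          _ ≤ _ := mul_le_mul_of_nonneg_right (hG _ hx) (by positivity)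
    _ = _ := by
        simp only [I]
        rw [Finset.card_product, Finset.card_range, nsmul_eq_mul]
        push_cast
        ring

open scoped Classical in
/-- The words that begin with the initial segment of `s` of length `⌈lam |s|⌉`. -/
noncomputable def prefixBlock (lam : ℝ) (s : CyclicallyReducedWord m ℓ) :
    Finset (CyclicallyReducedWord m ℓ) :=
  Finset.univ.filter fun s' => s.val.take ⌈lam * s.val.length⌉₊ <+: s'.val

theorem mem_prefixBlock {s s' : CyclicallyReducedWord m ℓ} :
    s' ∈ prefixBlock lam s ↔ s.val.take ⌈lam * s.val.length⌉₊ <+: s'.val := by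
  simp [prefixBlock]

/-- A word in both blocks makes the two defining initial segments comparable. -/
theorem mem_prefixBlock_of_not_disjoint (s s' : CyclicallyReducedWord m ℓ)
    (h : ¬ Disjoint (prefixBlock lam s) (prefixBlock lam s')) :
    s' ∈ prefixBlock lam s ∨ s ∈ prefixBlock lam s' := by
  obtain ⟨t, hs, hs'⟩ := Finset.not_disjoint_iff.1 h
  rw [mem_prefixBlock] at hs hs' ⊢
  rw [mem_prefixBlock]
  rcases List.prefix_or_prefix_of_prefix hs hs' with h | h
  · exact Or.inl (h.trans (List.take_prefix _ _))
  · exact Or.inr (h.trans (List.take_prefix _ _))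

theorem notMem_prefixBlock_of_smallCancellation (hlam1 : lam < 1)
    {R : Finset (CyclicallyReducedWord m ℓ)} (h : SmallCancellation lam (relatorWords R)) :
    ∀ s ∈ R, ∀ s' ∈ R, s ≠ s' → s' ∉ prefixBlock lam s := by
  intro s hs s' hs' hne hmem
  have hc : ∀ t ∈ R, t.val ∈ symmetrizedClosure (relatorWords R) := fun t ht =>
    mem_symmetrizedClosure_relatorWords.2 ⟨t, ht, mem_conjugates.2 (Or.inl (List.IsRotated.refl _))⟩
  have hp := List.take_prefix ⌈lam * s.val.length⌉₊ s.val
  have := h s.val (hc s hs) _ ⟨s.val, hc s hs, s'.val, hc s' hs',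
    fun h => hne (Subtype.ext h), hp, mem_prefixBlock.1 hmem⟩ hp
  rw [List.length_take_of_le (ceil_mul_length_le hlam1 _)] at this
  exact absurd (Nat.le_ceil _) (not_le.2 this)

theorem pow_le_card_prefixBlock (hm : 2 ≤ m) (hlam0 : 0 < lam) (hlam1 : lam < 1)
    (hℓ : ⌈lam * ℓ⌉₊ + 1 ≤ ℓ) (s : CyclicallyReducedWord m ℓ) :
    (2 * m - 1) ^ (ℓ - 1 - ⌈lam * ℓ⌉₊) ≤ (prefixBlock lam s).card := by
  have hpos : 0 < s.val.length := List.length_pos_iff.2 s.2.2.1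
  have hle : ⌈lam * s.val.length⌉₊ ≤ ⌈lam * ℓ⌉₊ := by
    refine Nat.ceil_mono (mul_le_mul_of_nonneg_left ?_ hlam0.le)
    exact_mod_cast s.2.2.2
  have hpos' : 0 < ⌈lam * s.val.length⌉₊ :=
    Nat.ceil_pos.2 (mul_pos hlam0 (by exact_mod_cast hpos))
  have hlen : (s.val.take ⌈lam * s.val.length⌉₊).length = ⌈lam * s.val.length⌉₊ :=
    List.length_take_of_le (ceil_mul_length_le hlam1 _)
  have h := pow_le_card_cyclicallyReducedWord_prefix hm (ℓ := ℓ)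
    (u := s.val.take ⌈lam * s.val.length⌉₊) (s.2.1.isReduced.take _)
    (List.ne_nil_of_length_pos (by omega)) (by omega)
  rw [hlen] at h
  refine (Nat.pow_le_pow_right (by omega) (by omega)).trans (h.trans (le_of_eq ?_))
  rw [prefixBlock]

end Overlaps

/-! ### Asymptotics -/

theorem tendsto_add_one_pow_mul_pow_atTop_nhds_zero (k : ℕ) {ρ : ℝ} (h0 : 0 < ρ) (h1 : ρ < 1) :
    Tendsto (fun n : ℕ => ((n : ℝ) + 1) ^ k * ρ ^ n) atTop (𝓝 0) := by
  have h := ((tendsto_pow_const_mul_const_pow_of_abs_lt_one k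
    (by rwa [abs_of_pos h0])).comp (tendsto_add_atTop_nat 1)).const_mul ρ⁻¹
  rw [mul_zero] at h
  refine h.congr fun n => ?_
  simp only [Function.comp_apply, Nat.cast_add, Nat.cast_one, pow_succ]
  field_simp

theorem two_le_card_cyclicallyReducedWord {m ℓ : ℕ} (hm : 2 ≤ m) (hℓ : 3 ≤ ℓ) :
    2 ≤ Fintype.card (CyclicallyReducedWord m ℓ) :=
  calc 2 ≤ 2 * m - 1 := by omega
    _ = (2 * m - 1) ^ 1 := (pow_one _).symm
    _ ≤ (2 * m - 1) ^ (ℓ - 2) := Nat.pow_le_pow_right (by omega) (by omega)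
    _ ≤ _ := pow_le_card_cyclicallyReducedWord hm (by omega)

section

variable {m : ℕ} {lam : ℝ} {d : EReal} {Ω : ℕ → Type*} [∀ ℓ, MeasurableSpace (Ω ℓ)]
  {P : ∀ ℓ, Measure (Ω ℓ)} [∀ ℓ, IsProbabilityMeasure (P ℓ)]
  {R : ∀ ℓ, Ω ℓ → Finset (CyclicallyReducedWord m ℓ)}

theorem IsRandomGroupSequence.tendsto_measure_card_le (hm : 2 ≤ m)
    (hR : IsRandomGroupSequence m d P R) {x : ℝ} (hx : d < (x : EReal)) :
    Tendsto (fun ℓ => P ℓ {ω | (R ℓ ω).card ∈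
      {k : ℕ | (k : ℝ) ≤ (Fintype.card (CyclicallyReducedWord m ℓ) : ℝ) ^ x}}) atTop (𝓝 1) := by
  refine tendsto_of_tendsto_of_tendsto_of_le_of_le'
    (hR.densable.tendsto_measure_of_isOpen isOpen_Iio hx) tendsto_const_nhds ?_
    (Eventually.of_forall fun n => prob_le_one)
  filter_upwards [eventually_ge_atTop 3] with ℓ hℓ
  exact measure_mono fun ω hω =>
    card_le_rpow_of_density_lt (two_le_card_cyclicallyReducedWord hm hℓ) hω

theorem IsRandomGroupSequence.tendsto_measure_le_card (hm : 2 ≤ m)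
    (hR : IsRandomGroupSequence m d P R) {x : ℝ} (hx : (x : EReal) < d) :
    Tendsto (fun ℓ => P ℓ {ω | (R ℓ ω).card ∈
      {k : ℕ | (Fintype.card (CyclicallyReducedWord m ℓ) : ℝ) ^ x ≤ k}}) atTop (𝓝 1) := by
  refine tendsto_of_tendsto_of_tendsto_of_le_of_le'
    (hR.densable.tendsto_measure_of_isOpen isOpen_Ioi hx) tendsto_const_nhds ?_
    (Eventually.of_forall fun n => prob_le_one)
  filter_upwards [eventually_ge_atTop 3] with ℓ hℓ
  exact measure_mono fun ω hω =>
    rpow_le_card_of_lt_density (two_le_card_cyclicallyReducedWord hm hℓ) hω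

theorem IsRandomGroupSequence.asymptoticallyAlmostSurely_smallCancellation (hm : 2 ≤ m)
    (hlam1 : lam < 1) (hR : IsRandomGroupSequence m d P R)
    (hd : d < ((lam / 2 : ℝ) : EReal)) :
    AsymptoticallyAlmostSurely P (fun ℓ ω => SmallCancellation lam (relatorWords (R ℓ ω))) := by
  classical
  obtain ⟨x, hdx, hx⟩ := EReal.lt_iff_exists_real_btwn.1 hd
  rw [EReal.coe_lt_coe_iff] at hx
  set q : ℕ := 2 * m - 1 with hq
  have hq1 : (1 : ℝ) < q := by exact_mod_cast (by omega : 1 < q)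
  have hq0 : (0 : ℝ) < q := by linarith
  set C : ℝ := (q : ℝ) ^ (2 * (1 - x)) with hC
  set ρ : ℝ := (q : ℝ) ^ (x - lam / 2) with hρ
  have hρ0 : 0 < ρ := Real.rpow_pos_of_pos hq0 _
  have hρ1 : ρ < 1 := Real.rpow_lt_one_of_one_lt_of_neg hq1 (by linarith)
  have hC0 : 0 < C := Real.rpow_pos_of_pos hq0 _
  set ε : ℕ → ℝ := fun ℓ => 8 * C * (((ℓ : ℝ) + 1) ^ 3 * ρ ^ ℓ) +
    16 * C ^ 2 * (((ℓ : ℝ) + 1) ^ 2 * ρ ^ ℓ) ^ 2 with hε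
  have hεlim : Tendsto ε atTop (𝓝 0) := by
    have h1 := (tendsto_add_one_pow_mul_pow_atTop_nhds_zero 3 hρ0 hρ1).const_mul (8 * C)
    have h2 := ((tendsto_add_one_pow_mul_pow_atTop_nhds_zero 2 hρ0 hρ1).pow 2).const_mul
      (16 * C ^ 2)
    simpa using h1.add h2
  have key := asymptoticallyAlmostSurely_of_proportion_tendsto_zero hR.isRandomSubset
    hR.permutationInvariant (fun ℓ a => ¬ SmallCancellation lam (relatorWords a)) _
    (hR.tendsto_measure_card_le hm hdx) hεlim (fun ℓ => by positivity) ?_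
  · simpa only [not_not] using key
  filter_upwards [eventually_ge_atTop 3] with ℓ hℓ k hk
  set N := Fintype.card (CyclicallyReducedWord m ℓ) with hN
  have hN2 : 2 ≤ N := two_le_card_cyclicallyReducedWord hm hℓ
  have hN0 : (0 : ℝ) < N := by exact_mod_cast (by omega : 0 < N)
  -- The expected number of self-overlapping relators and, squared, of overlapping pairs of
  -- relators, both up to a polynomial factor.
  have hy : (q : ℝ) ^ ((1 - lam / 2) * ℓ) * (k / N) ≤ C * ρ ^ ℓ := by
    have hle : ((q : ℝ) ^ ((ℓ : ℝ) - 2)) ≤ N := by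
      have := pow_le_card_cyclicallyReducedWord hm (ℓ := ℓ) (by omega)
      calc ((q : ℝ) ^ ((ℓ : ℝ) - 2)) = ((q ^ (ℓ - 2) : ℕ) : ℝ) := by
            rw [Nat.cast_pow, ← Real.rpow_natCast, Nat.cast_sub (show 2 ≤ ℓ by omega),
              Nat.cast_ofNat]
        _ ≤ N := by exact_mod_cast this
    have hkN : (k / N : ℝ) ≤ (N : ℝ) ^ (x - 1) := by
      rw [Real.rpow_sub_one hN0.ne']
      exact div_le_div_of_nonneg_right hk hN0.le
    calc (q : ℝ) ^ ((1 - lam / 2) * ℓ) * (k / N)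
        ≤ (q : ℝ) ^ ((1 - lam / 2) * ℓ) * ((q : ℝ) ^ ((ℓ : ℝ) - 2)) ^ (x - 1) := by
          refine mul_le_mul_of_nonneg_left (hkN.trans ?_) (by positivity)
          exact Real.rpow_le_rpow_of_nonpos (by positivity) hle (by linarith)
      _ = C * ρ ^ ℓ := by
          rw [hC, hρ, ← Real.rpow_natCast (_ ^ _), ← Real.rpow_mul hq0.le, ← Real.rpow_mul hq0.le,
            ← Real.rpow_add hq0, ← Real.rpow_add hq0]
          congr 1
          ring
  have hS := card_selfOverlapping_le (m := m) (ℓ := ℓ) (by omega) hlam1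
  have hT := card_overlapping_le (m := m) (ℓ := ℓ) (by omega) hlam1
  have hfirst := Finset.card_filter_exists_mem_or_exists_pair_le
    (selfOverlapping lam m ℓ) (overlapping lam m ℓ) k
  refine (Nat.cast_le.2 (Finset.card_le_card ?_)).trans (hfirst.trans ?_)
  · intro a ha
    simp only [Finset.mem_filter, Finset.mem_univ, true_and] at ha ⊢
    obtain ⟨hk, h⟩ := ha
    exact ⟨hk, exists_overlap_of_not_smallCancellation h⟩
  · refine mul_le_mul_of_nonneg_right ?_ (Nat.cast_nonneg _)
    rw [← hN]
    set Y : ℝ := (q : ℝ) ^ ((1 - lam / 2) * ℓ) with hY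
    have hY0 : 0 ≤ Y * (k / N) := by positivity
    calc _ ≤ 8 * ((ℓ : ℝ) + 1) ^ 3 * Y * (k / N) + 16 * ((ℓ : ℝ) + 1) ^ 4 * Y ^ 2 * (k / N) ^ 2 :=
          add_le_add (mul_le_mul_of_nonneg_right hS (by positivity))
            (mul_le_mul_of_nonneg_right hT (by positivity))
      _ = 8 * ((ℓ : ℝ) + 1) ^ 3 * (Y * (k / N)) + 16 * ((ℓ : ℝ) + 1) ^ 4 * (Y * (k / N)) ^ 2 := by
          ring
      _ ≤ 8 * ((ℓ : ℝ) + 1) ^ 3 * (C * ρ ^ ℓ) + 16 * ((ℓ : ℝ) + 1) ^ 4 * (C * ρ ^ ℓ) ^ 2 := by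
          gcongr
      _ = ε ℓ := by rw [hε]; ring

theorem IsRandomGroupSequence.asymptoticallyAlmostSurely_not_smallCancellation (hm : 2 ≤ m)
    (hlam0 : 0 < lam) (hlam1 : lam < 1) (hR : IsRandomGroupSequence m d P R)
    (hd : ((lam / 2 : ℝ) : EReal) < d) :
    AsymptoticallyAlmostSurely P (fun ℓ ω => ¬ SmallCancellation lam (relatorWords (R ℓ ω))) := by
  classical
  -- The bound `x < 1 / 2` gives `N ^ (2 * x - 1)` a nonpositive exponent, so that an upper bound
  -- on `N` bounds it from below.
  obtain ⟨x, hx, hxd⟩ := EReal.lt_iff_exists_real_btwn.1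
    (lt_min hd (EReal.coe_lt_coe_iff.2 (by linarith : lam / 2 < 1 / 2)))
  have hx2 := hxd.trans_le (min_le_right _ _)
  have hxd := hxd.trans_le (min_le_left _ _)
  rw [EReal.coe_lt_coe_iff] at hx hx2
  set q : ℕ := 2 * m - 1 with hq
  have hq1 : (1 : ℝ) < q := by exact_mod_cast (by omega : 1 < q)
  have hq0 : (0 : ℝ) < q := by linarith
  set ρ : ℝ := (q : ℝ) ^ (lam - 2 * x) with hρ
  have hρ0 : 0 < ρ := Real.rpow_pos_of_pos hq0 _
  have hρ1 : ρ < 1 := Real.rpow_lt_one_of_one_lt_of_neg hq1 (by linarith)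
  set Z : ℕ → ℝ := fun ℓ => (16 * (q : ℝ) ^ 2)⁻¹ * (((ℓ : ℝ) + 1) ^ 1 * ρ ^ ℓ)⁻¹ with hZ
  have hZlim : Tendsto Z atTop atTop := by
    refine Tendsto.const_mul_atTop (by positivity) (tendsto_inv_nhdsGT_zero.comp ?_)
    exact tendsto_nhdsWithin_iff.2 ⟨tendsto_add_one_pow_mul_pow_atTop_nhds_zero 1 hρ0 hρ1,
      Eventually.of_forall fun n => Set.mem_Ioi.2 (by positivity)⟩
  have hεlim : Tendsto (fun ℓ => Real.exp (-Z ℓ)) atTop (𝓝 0) :=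
    Real.tendsto_exp_neg_atTop_nhds_zero.comp hZlim
  have hlarge : ∀ᶠ ℓ : ℕ in atTop, 3 ≤ (1 - lam) * ℓ :=
    (tendsto_natCast_atTop_atTop.const_mul_atTop (by linarith)).eventually_ge_atTop 3
  refine asymptoticallyAlmostSurely_of_proportion_tendsto_zero hR.isRandomSubset
    hR.permutationInvariant (fun ℓ a => SmallCancellation lam (relatorWords a)) _
    (hR.tendsto_measure_le_card hm hxd) hεlim (fun ℓ => (Real.exp_pos _).le) ?_
  filter_upwards [eventually_ge_atTop 3, hlarge] with ℓ hℓ hℓlam k hk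
  set N := Fintype.card (CyclicallyReducedWord m ℓ) with hN
  have hN2 : 2 ≤ N := two_le_card_cyclicallyReducedWord hm hℓ
  have hN1 : (1 : ℝ) < N := by exact_mod_cast (by omega : 1 < N)
  have hN0 : (0 : ℝ) < N := by linarith
  have hk : (N : ℝ) ^ x ≤ k := hk
  have hk2 : (2 : ℝ) ≤ k := by
    have h1 : (1 : ℝ) < k := (Real.one_lt_rpow hN1 (by linarith)).trans_le hk
    have h2 : 1 < k := by exact_mod_cast h1
    exact_mod_cast h2
  have hceil : (⌈lam * ℓ⌉₊ : ℝ) < lam * ℓ + 1 := Nat.ceil_lt_add_one (by positivity)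
  have hT : ⌈lam * ℓ⌉₊ + 2 ≤ ℓ := by
    have : (⌈lam * ℓ⌉₊ : ℝ) + 2 ≤ ℓ := by linarith
    exact_mod_cast this
  set δ : ℕ := q ^ (ℓ - 1 - ⌈lam * ℓ⌉₊) with hδ
  have hδ2 : (2 : ℝ) ≤ δ := by
    have : 2 ≤ δ :=
      calc 2 ≤ q ^ 1 := by rw [pow_one]; omega
        _ ≤ δ := Nat.pow_le_pow_right (by omega) (by omega)
    exact_mod_cast this
  have hmain := Finset.card_filter_pairwise_notMem_le (prefixBlock (m := m) (ℓ := ℓ) lam)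
    mem_prefixBlock_of_not_disjoint (δ := δ) (Nat.one_le_pow _ _ (by omega))
    (pow_le_card_prefixBlock hm hlam0 hlam1 (by omega)) k
  refine (Nat.cast_le.2 (Finset.card_le_card ?_)).trans (hmain.trans ?_)
  · intro a ha
    obtain ⟨-, hk, h⟩ := Finset.mem_filter.1 ha
    exact Finset.mem_filter.2
      ⟨Finset.mem_univ _, hk, notMem_prefixBlock_of_smallCancellation hlam1 h⟩
  refine mul_le_mul_of_nonneg_right (Real.exp_le_exp.2 (neg_le_neg ?_)) (Nat.cast_nonneg _)
  rw [← hN]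
  have hδle : (q : ℝ) ^ ((1 - lam) * ℓ - 2) ≤ δ := by
    rw [hδ, Nat.cast_pow, ← Real.rpow_natCast]
    refine Real.rpow_le_rpow_of_exponent_le hq1.le ?_
    rw [Nat.cast_sub (by omega), Nat.cast_sub (by omega)]
    push_cast
    linarith
  have hNpow : (2 * ((ℓ : ℝ) + 1))⁻¹ * (q : ℝ) ^ ((2 * x - 1) * ℓ) ≤ (N : ℝ) ^ (2 * x - 1) := by
    have hle : (N : ℝ) ≤ 2 * ((ℓ : ℝ) + 1) * (q : ℝ) ^ ℓ := by
      exact_mod_cast card_cyclicallyReducedWord_le (m := m) (by omega) ℓ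
    refine le_trans ?_ (Real.rpow_le_rpow_of_nonpos hN0 hle (by linarith))
    rw [Real.mul_rpow (by positivity) (by positivity), ← Real.rpow_natCast, ← Real.rpow_mul hq0.le,
      mul_comm (ℓ : ℝ)]
    refine mul_le_mul_of_nonneg_right ?_ (by positivity)
    rw [← Real.rpow_neg_one]
    refine Real.rpow_le_rpow_of_exponent_le ?_ (by linarith)
    have : (0 : ℝ) ≤ ℓ := Nat.cast_nonneg ℓ
    linarith
  have hk2N : (N : ℝ) ^ (2 * x - 1) ≤ k ^ 2 / N := by
    rw [Real.rpow_sub_one hN0.ne', mul_comm, Real.rpow_mul hN0.le, Real.rpow_two]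
    exact div_le_div_of_nonneg_right (pow_le_pow_left₀ (by positivity) hk 2) hN0.le
  calc Z ℓ = (q : ℝ) ^ ((1 - lam) * ℓ - 2) *
        ((2 * ((ℓ : ℝ) + 1))⁻¹ * (q : ℝ) ^ ((2 * x - 1) * ℓ)) / 8 := by
        have h1 : (q : ℝ) ^ ((1 - lam) * ℓ - 2) * (q : ℝ) ^ ((2 * x - 1) * ℓ) =
            (ρ ^ ℓ)⁻¹ * ((q : ℝ) ^ 2)⁻¹ := by
          rw [hρ, ← Real.rpow_natCast (_ ^ _), ← Real.rpow_mul hq0.le, ← Real.rpow_neg hq0.le,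
            ← Real.rpow_two, ← Real.rpow_neg hq0.le, ← Real.rpow_add hq0, ← Real.rpow_add hq0]
          congr 1
          ring
        calc Z ℓ = (16 * ((ℓ : ℝ) + 1))⁻¹ * ((ρ ^ ℓ)⁻¹ * ((q : ℝ) ^ 2)⁻¹) := by
              simp only [hZ, mul_inv, pow_one]; ring
          _ = _ := by rw [← h1]; simp only [mul_inv]; ring
    _ ≤ δ * (k ^ 2 / N) / 8 := by
        have h := hNpow.trans hk2N
        gcongr
    _ = δ / 2 * (k * (k / 2) / 2) / N := by ring
    _ ≤ (δ - 1) * (k * (k - 1) / 2) / N := by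
        gcongr <;> linarith
    _ = (δ - 1) / N * (k * (k - 1) / 2) := by ring

end

theorem mainTheorem3 (m : ℕ) (hm : 2 ≤ m) (lam : ℝ) (hlam0 : 0 < lam) (hlam1 : lam < 1)
    (d : EReal) (hd : d = ⊥ ∨ (0 ≤ d ∧ d ≤ 1))
    {Ω : ℕ → Type*} [∀ ℓ, MeasurableSpace (Ω ℓ)]
    (P : ∀ ℓ, Measure (Ω ℓ)) [∀ ℓ, IsProbabilityMeasure (P ℓ)]
    (R : ∀ ℓ, Ω ℓ → Finset (CyclicallyReducedWord m ℓ))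
    (hR : IsRandomGroupSequence m d P R) :
    (d < ((lam / 2 : ℝ) : EReal) →
      AsymptoticallyAlmostSurely P
        (fun ℓ ω => SmallCancellation lam (relatorWords (R ℓ ω)))) ∧
    (((lam / 2 : ℝ) : EReal) < d →
      AsymptoticallyAlmostSurely P
        (fun ℓ ω => ¬ SmallCancellation lam (relatorWords (R ℓ ω)))) := by
  exact ⟨hR.asymptoticallyAlmostSurely_smallCancellation hm hlam1,
    hR.asymptoticallyAlmostSurely_not_smallCancellation hm hlam0 hlam1⟩
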